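/- **Setting.** There are $J$ units and $T=T_0+T_1$ periods, $T_1\ge 1$; the last $T_1$ periods are post-intervention. Potential outcomes follow the factor model $$Y^N_{jt}=\delta_t+\theta_t'Z_j+\lambda_t'\mu_j+\epsilon_{jt}\quad(1\le t\le T),\qquad Y^I_{jt}=\upsilon_t+\gamma_t'Z_j+\eta_t'\mu_j+\xi_{jt}\quad(T_0<t\le T),$$ with nonrandom $\delta_t,\upsilon_t\in\mathbb R$, $Z_j,\theta_t,\gamma_t\in\mathbb R^r$, $\mu_j,\lambda_t,\eta_t\in\mathbb R^F$ and random shocks $\epsilon_{jt},\xi_{jt}$. Fix a set $\mathcal E\subseteq\{1,\dots,T_0\}$ of fitting periods, $T_{\mathcal E}=|\mathcal E|$; the blank periods are $\mathcal B=\{1,\dots,T_0\}\setminus\mathcal E$. Let $f_1,\dots,f_J>0$ with $\sum_j f_j=1$, let $1\le\underline m\le\overline m\le J-1$, and let $X_j=((Y_{jt})_{t\in\mathcal E},Z_j)$, $\overline X=\sum_j f_jX_j$. The random weights $w^*,v^*$ are measurable functions of $(X_1,\dots,X_J)$ that almost surely minimize $\|\overline X-\sum_j w_jX_j\|^2+\|\overline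 X-\sum_j v_jX_j\|^2$ subject to $\sum_j w_j=\sum_j v_j=1$, $w_j,v_j\ge 0$, $w_jv_j=0$ and $\underline m\le\|w\|_0\le\overline m$. The observed outcome is $Y_{jt}=Y^I_{jt}$ if $t>T_0$ and $w^*_j>0$, and $Y_{jt}=Y^N_{jt}$ otherwise. **Assumptions.** 1. $|\lambda_{t,k}|\le\bar\lambda$ for all $t\le T$ and $|\eta_{t,k}|\le\bar\eta$ for $t>T_0$, for all $k\le F$. 2. $T_{\mathcal E}\ge F$, and $\underline\zeta=\zeta_{\mathcal E}/T_{\mathcal E}>0$, where $\zeta_{\mathcal E}$ is the smallest eigenvalue of $\sum_{t\in\mathcal E}\lambda_t\lambda_t'$. 3. The shocks of different (unit, period) pairs are independent, where the shock of $(j,t)$ is $\epsilon_{jt}$ for $t\le T_0$ and the vector $(\epsilon_{jt},\xi_{jt})$ for $t>T_0$. All $\epsilon_{jt}$ and $\xi_{jt}$ have mean zero and are sub-Gaussian with variance proxy $\bar\sigma^2$. For $t\notin\mathcal E$ the $\epsilon_{jt}$ are identically distributed over $j$ and $t$, with a density bounded by a constant $\kappa<\infty$. (In particular this holds if the $\epsilon_{jt}$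 are i.i.d. over all $j,t$ with a density bounded by $\kappa$.) 4. (Perfect fit.) Almost surely $\sum_j w^*_jX_j=\overline X=\sum_j v^*_jX_j$. 5. (Null hypothesis.) $Y^I_{jt}=\delta_t+\theta_t'Z_j+\lambda_t'\mu_j+\xi_{jt}$ with $\xi_{jt}$ distributed as $\epsilon_{jt}$, for all $j$ and $t>T_0$. **The $p$-value.** Let $\widehat r\in\mathbb R^{T-T_{\mathcal E}}$ list $\sum_j w^*_jY_{jt}-\sum_j v^*_jY_{jt}$, first for $t=T_0+1,\dots,T$, then for $t\in\mathcal B$. Let $\Pi$ be the set of all $T_1$-element subsets of $\{1,\dots,T-T_{\mathcal E}\}$, let $S_\pi=\frac1{T_1}\sum_{i\in\pi}|\widehat r_i|$ for $\pi\in\Pi$, and let $$\widehat p=\frac1{|\Pi|}\#\{\pi\in\Pi:\ S_\pi\ge S_{\{1,\dots,T_1\}}\}.$$ **Theorem.** There is an event $C$ with $\Pr(C)\ge 1-c_1(T_{\mathcal E})$, where $$c_1(T_{\mathcal E})=2J(T-T_{\mathcal E})\exp\Big(-\frac{\underline\zeta^2}{8\bar\sigma^2\bar\lambda^4F^2}\,T_{\mathcal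 E}^{1/2}\Big)+2JT_1\kappa|\Pi|^2\,T_{\mathcal E}^{-1/4},$$ such that, if $\Pr(C)>0$, then for every $\alpha\in(0,1]$ $$\alpha-\frac1{|\Pi|}\le\Pr(\widehat p\le\alpha\mid C)\le\alpha .$$ -/

import Mathlib

open MeasureTheory ProbabilityTheory
open scoped NNReal ENNReal Matrix

namespace SCDesign

/-- Time periods: `Sum.inl s` is the `s`-th of the `T₀` pre-intervention periods, `Sum.inr t` is the
`t`-th of the `T₁` post-intervention periods, so that there are `T = T₀ + T₁` periods in all. -/
abbrev Period (T₀ T₁ : ℕ) : Type := Fin T₀ ⊕ Fin T₁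

/-- The blank periods for the set `E` of fitting periods: all pre-intervention periods not in `E`. -/
abbrev Blank {T₀ : ℕ} (E : Finset (Fin T₀)) : Type := {s : Fin T₀ // s ∉ E}

/-- The set of periods (pre- or post-intervention) that are not fitting periods. -/
def nonFitting {T₀ : ℕ} (T₁ : ℕ) (E : Finset (Fin T₀)) : Set (Period T₀ T₁) :=
  {t | ∀ s ∈ E, t ≠ Sum.inl s}

/-- The primitives of the linear factor model for `J` units, `r` observed and `F` unobserved
covariates: nonrandom coefficients and covariates, and random shocks on `Ω`. Outcomes under treatment
only exist in post-intervention periods. -/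
structure FactorModel (J T₀ T₁ r F : ℕ) (Ω : Type*) where
  /-- observed covariates -/
  Z : Fin J → Fin r → ℝ
  /-- unobserved covariates -/
  mu : Fin J → Fin F → ℝ
  /-- time effects without treatment -/
  delta : Period T₀ T₁ → ℝ
  /-- coefficients of the observed covariates without treatment -/
  theta : Period T₀ T₁ → Fin r → ℝ
  /-- factor loadings without treatment -/
  lam : Period T₀ T₁ → Fin F → ℝ
  /-- shocks without treatment -/
  eps : Fin J → Period T₀ T₁ → Ω → ℝ
  /-- time effects under treatment -/
  upsilon : Fin T₁ → ℝ
  /-- coefficients of the observed covariates under treatment -/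
  gam : Fin T₁ → Fin r → ℝ
  /-- factor loadings under treatment -/
  eta : Fin T₁ → Fin F → ℝ
  /-- shocks under treatment -/
  xi : Fin J → Fin T₁ → Ω → ℝ

/-! ### The design problem -/

section Design

variable {J : ℕ} {V : Type*} [NormedAddCommGroup V] [NormedSpace ℝ V]

/-- The feasible pairs of weights `(w, v)`, with between `mlo` and `mhi` treated units. -/
def feasible (J mlo mhi : ℕ) : Set ((Fin J → ℝ) × (Fin J → ℝ)) :=
  {p | ∑ j, p.1 j = 1 ∧ ∑ j, p.2 j = 1 ∧ (∀ j, 0 ≤ p.1 j ∧ 0 ≤ p.2 j) ∧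
    (∀ j, p.1 j * p.2 j = 0) ∧
    mlo ≤ (Finset.univ.filter fun j => p.1 j ≠ 0).card ∧
    (Finset.univ.filter fun j => p.1 j ≠ 0).card ≤ mhi}

/-- The objective: squared discrepancies between the `f`-weighted average of the predictors `X` and
their `w`- and `v`-weighted averages. -/
noncomputable def objective (f : Fin J → ℝ) (X : Fin J → V) (p : (Fin J → ℝ) × (Fin J → ℝ)) : ℝ :=
  ‖∑ j, f j • X j - ∑ j, p.1 j • X j‖ ^ 2 + ‖∑ j, f j • X j - ∑ j, p.2 j • X j‖ ^ 2

/-- `(w, v)` solves the design problem with population weights `f` and predictors `X`. -/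
def IsSolution (mlo mhi : ℕ) (f : Fin J → ℝ) (X : Fin J → V) (w v : Fin J → ℝ) : Prop :=
  (w, v) ∈ feasible J mlo mhi ∧ IsMinOn (objective f X) (feasible J mlo mhi) (w, v)

end Design

namespace FactorModel

variable {J T₀ T₁ r F : ℕ} {Ω : Type*} (M : FactorModel J T₀ T₁ r F Ω)

/-- Potential outcome of unit `j` in period `t` without treatment. -/
def YN (j : Fin J) (t : Period T₀ T₁) (ω : Ω) : ℝ :=
  M.delta t + M.theta t ⬝ᵥ M.Z j + M.lam t ⬝ᵥ M.mu j + M.eps j t ω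

/-- Potential outcome of unit `j` in the post-intervention period `t` under treatment. -/
def YI (j : Fin J) (t : Fin T₁) (ω : Ω) : ℝ :=
  M.upsilon t + M.gam t ⬝ᵥ M.Z j + M.eta t ⬝ᵥ M.mu j + M.xi j t ω

/-- Observed outcome when exactly the units with `w ω j > 0` are treated in the post-intervention
periods. -/
noncomputable def Y (w : Ω → Fin J → ℝ) (j : Fin J) : Period T₀ T₁ → Ω → ℝ
  | Sum.inl s, ω => M.YN j (Sum.inl s) ω
  | Sum.inr t, ω => if 0 < w ω j then M.YI j t ω else M.YN j (Sum.inr t) ω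

/-- The vector of predictors of unit `j`: outcomes in the fitting periods, and observed covariates. -/
noncomputable def predictors (E : Finset (Fin T₀)) (ω : Ω) (j : Fin J) :
    EuclideanSpace ℝ (E ⊕ Fin r) :=
  WithLp.toLp 2 (Sum.elim (fun s : E => M.YN j (Sum.inl s.1) ω) (M.Z j))

/-- The shocks of unit `j` in period `t`: `(ε, ξ)` in a post-intervention period, only `ε` (padded by
a zero) in a pre-intervention period. -/
def shocks (j : Fin J) : Period T₀ T₁ → Ω → ℝ × ℝ
  | Sum.inl s, ω => (M.eps j (Sum.inl s) ω, 0)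
  | Sum.inr t, ω => (M.eps j (Sum.inr t) ω, M.xi j t ω)

/-- The matrix whose rows are the loadings `λ_t`, for `t` in the fitting periods. -/
def lamE (E : Finset (Fin T₀)) : Matrix E (Fin F) ℝ :=
  Matrix.of fun s f => M.lam (Sum.inl s.1) f

/-- The smallest eigenvalue of `λ_E' λ_E`, divided by the number of fitting periods. -/
noncomputable def zeta (E : Finset (Fin T₀)) : ℝ :=
  (⨅ i, (Matrix.isHermitian_conjTranspose_mul_self (M.lamE E)).eigenvalues i) / (E.card : ℝ)

/-- The null hypothesis: in post-intervention periods the potential outcome under treatment has the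
systematic part of the potential outcome without treatment, and its shock `ξ` has the same
distribution as `ε`. -/
def NullHypothesis [MeasurableSpace Ω] (P : Measure Ω) : Prop :=
  ∀ (j : Fin J) (t : Fin T₁),
    (∀ ω, M.YI j t ω = M.delta (Sum.inr t) + M.theta (Sum.inr t) ⬝ᵥ M.Z j
      + M.lam (Sum.inr t) ⬝ᵥ M.mu j + M.xi j t ω) ∧
    IdentDistrib (M.xi j t) (M.eps j (Sum.inr t)) P P

/-- The weights `w` fit the population averages of the observed covariates, and of the outcomes in the
fitting periods, exactly. -/
def PerfectFit (E : Finset (Fin T₀)) (f : Fin J → ℝ) (ω : Ω) (w : Fin J → ℝ) : Prop :=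
  ∑ j, w j • M.Z j = ∑ j, f j • M.Z j ∧
  ∀ s ∈ E, ∑ j, w j * M.YN j (Sum.inl s) ω = ∑ j, f j * M.YN j (Sum.inl s) ω

/-- Synthetic treated outcome minus synthetic control outcome in period `t`: the estimated treatment
effect `τ̂_t` in a post-intervention period, the placebo effect `û_t` in a blank period. -/
noncomputable def effect (w v : Ω → Fin J → ℝ) (t : Period T₀ T₁) (ω : Ω) : ℝ :=
  ∑ j, w ω j * M.Y w j t ω - ∑ j, v ω j * M.Y w j t ω

/-- The vector `r̂` of the post-intervention estimates followed by the placebo estimates. -/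
noncomputable def rhat (E : Finset (Fin T₀)) (w v : Ω → Fin J → ℝ) (ω : Ω) :
    Fin T₁ ⊕ Blank E → ℝ
  | Sum.inl t => M.effect w v (Sum.inr t) ω
  | Sum.inr s => M.effect w v (Sum.inl s.1) ω

end FactorModel

/-! ### The permutation test -/

/-- The test statistic: the average of the absolute values of the coordinates. -/
noncomputable def testStat {ι : Type*} [Fintype ι] (e : ι → ℝ) : ℝ :=
  (1 / (Fintype.card ι : ℝ)) * ∑ i, |e i|

/-- The set `Π` of all `T₁`-combinations of the `T₁ + (T₀ - |E|)` indices of `r̂`. -/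
def combinations {T₀ : ℕ} (T₁ : ℕ) (E : Finset (Fin T₀)) : Finset (Finset (Fin T₁ ⊕ Blank E)) :=
  Finset.powersetCard T₁ Finset.univ

/-- The permutation `p`-value of a vector `ρ` of post-intervention and placebo estimates: the
proportion of the combinations `π` for which the statistic of the subvector `(ρ i)_{i ∈ π}` is at
least the statistic of the post-intervention subvector. -/
noncomputable def pValue {T₀ T₁ : ℕ} (E : Finset (Fin T₀)) (ρ : Fin T₁ ⊕ Blank E → ℝ) : ℝ :=
  (1 / ((combinations T₁ E).card : ℝ)) *
    ∑ π ∈ combinations T₁ E,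
      Set.indicator {π' : Finset (Fin T₁ ⊕ Blank E) |
        testStat (fun i : π' => ρ i.1) ≥ testStat (fun t : Fin T₁ => ρ (Sum.inl t))} (fun _ => (1 : ℝ)) π

/-- `X` is continuously distributed, with a version of its density bounded by `κ`. -/
def HasBoundedDensity {Ω : Type*} [MeasurableSpace Ω] (X : Ω → ℝ) (κ : ℝ) (P : Measure Ω) : Prop :=
  ∃ g : ℝ → ℝ, Measurable g ∧ (∀ x, 0 ≤ g x ∧ g x ≤ κ) ∧
    P.map X = volume.withDensity fun x => ENNReal.ofReal (g x)

/-- The error bound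
`c₁ = 2 J (T - T_E) exp(-(ζ² / (8 σ² λ⁴ F²)) T_E^{1/2}) + 2 J T₁ κ |Π|² T_E^{-1/4}`. -/
noncomputable def c₁ (J T₀ T₁ F : ℕ) (E : Finset (Fin T₀)) (ζ sigmaBar lamBar κ : ℝ) : ℝ :=
  2 * J * ((T₀ : ℝ) + T₁ - E.card) *
      Real.exp (-(ζ ^ 2 / (8 * sigmaBar ^ 2 * lamBar ^ 4 * (F : ℝ) ^ 2)) * Real.sqrt E.card)
    + 2 * J * T₁ * κ * ((combinations T₁ E).card : ℝ) ^ 2 * (E.card : ℝ) ^ (-(1 / 4) : ℝ)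

end SCDesign

/-! Write `c = w - v` and let `d = ∑ j, c j • mu j` be the imbalance of the unobserved covariates.
Under the null, treatment changes an observed outcome only by replacing `ε` with `ξ`. As the weights
balance constants and `Z`, each coordinate of `r̂` is a noise term `∑ j, c j * s (i, j)`, where `s`
holds the selected shocks, plus the perturbation `λ_t ⬝ᵥ d`.

The weights depend on fitting-period shocks only, and `ξ` has the law of `ε`, so `s` is an i.i.d.
array independent of the weights (`measurePreserving_weights_shocks`). Permuting its rows therefore
preserves the joint law. Without ties, the statistic of the noise at the post-intervention
combination then has an exactly uniform rank among all combinations.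

It remains to show that the perturbation rarely alters ranks. Let `C` be the event that every `|λ_t
⬝ᵥ d|` is at most `δ = T_E ^ (-1/4)` and that noise sums of absolute values over distinct
combinations differ by more than `2 * T₁ * δ`. On `C` each sum moves by at most `T₁ * δ`, so ranks
are those of the noise. Since `C` is defined through the weights and a symmetric condition on the
noise, it is invariant under row permutations, and uniformity survives conditioning
(`card_mul_measure_rankIn_le`): the conditional probability is exactly `⌊α|Π|⌋ / |Π|`.

Two estimates bound the probability of the complement. Perfect fit expresses `λ_t ⬝ᵥ d` through
averages of fitting-period shocks with small nonrandom coefficients, which are sub-Gaussian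
(`measureReal_imbalance_le`). Some `|c j|` is at least `2 / J`, so a bounded density makes near-ties
unlikely (`prod_not_separated_le`). -/

namespace SCDesign

/-! ### Ranks and the permutation `p`-value -/

/-- The sum of the absolute values of the coordinates of `ρ` with index in `π`. -/
def absSum {ι : Type*} (ρ : ι → ℝ) (π : Finset ι) : ℝ := ∑ i ∈ π, |ρ i|

/-- The number of elements of `s` whose `g`-value is at least that of `a`. -/
noncomputable def rankIn {α : Type*} (s : Finset α) (g : α → ℝ) (a : α) : ℕ :=
  (s.filter fun b => g a ≤ g b).card

theorem rankIn_lt_of_lt {α : Type*} {s : Finset α} {g : α → ℝ} {a b : α} (ha : a ∈ s)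
    (hab : g a < g b) : rankIn s g b < rankIn s g a := by
  refine Finset.card_lt_card ⟨fun c hc => ?_, fun h => ?_⟩
  · simp only [Finset.mem_filter] at hc ⊢
    exact ⟨hc.1, hab.le.trans hc.2⟩
  · have := h (Finset.mem_filter.2 ⟨ha, le_rfl⟩)
    exact absurd (Finset.mem_filter.1 this).2 hab.not_ge

/-- Without ties, exactly `m` elements have rank at most `m`. -/
theorem card_filter_rankIn_le {α : Type*} {s : Finset α} {g : α → ℝ} (hg : Set.InjOn g s) {m : ℕ}
    (hm : m ≤ s.card) : (s.filter fun a => rankIn s g a ≤ m).card = m := by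
  classical
  have hinj : Set.InjOn (rankIn s g) s := by
    intro a ha b hb hab
    rcases lt_trichotomy (g a) (g b) with h | h | h
    · exact absurd (rankIn_lt_of_lt ha h) hab.symm.not_lt.elim
    · exact hg ha hb h
    · exact absurd (rankIn_lt_of_lt hb h) hab.not_lt.elim
  -- Injective ranks with values in `1, …, s.card` must take every value once; ranks start at 1
  -- because an element counts itself.
  have himg : s.image (rankIn s g) = Finset.Icc 1 s.card := by
    refine Finset.eq_of_subset_of_card_le (fun k hk => ?_) ?_
    · obtain ⟨a, ha, rfl⟩ := Finset.mem_image.1 hk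
      exact Finset.mem_Icc.2 ⟨Finset.card_pos.2 ⟨a, Finset.mem_filter.2 ⟨ha, le_rfl⟩⟩,
        Finset.card_filter_le _ _⟩
    · rw [Finset.card_image_of_injOn hinj, Nat.card_Icc, Nat.add_sub_cancel]
  have himg' : (s.filter fun a => rankIn s g a ≤ m).image (rankIn s g) = Finset.Icc 1 m := by
    ext k
    have hk : k ∈ s.image (rankIn s g) ↔ k ∈ Finset.Icc 1 s.card := by rw [himg]
    simp only [Finset.mem_image, Finset.mem_filter, Finset.mem_Icc] at hk ⊢
    constructor
    · rintro ⟨a, ⟨ha, ham⟩, rfl⟩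
      exact ⟨(hk.1 ⟨a, ha, rfl⟩).1, ham⟩
    · rintro ⟨h1, h2⟩
      obtain ⟨a, ha, rfl⟩ := hk.2 ⟨h1, h2.trans hm⟩
      exact ⟨a, ⟨ha, h2⟩, rfl⟩
  rw [← Finset.card_image_of_injOn (hinj.mono (Finset.coe_subset.2 (Finset.filter_subset _ s))),
    himg', Nat.card_Icc, Nat.add_sub_cancel]

/-- The indices of the post-intervention estimates. -/
def postSet {T₀ : ℕ} (T₁ : ℕ) (E : Finset (Fin T₀)) : Finset (Fin T₁ ⊕ Blank E) :=
  Finset.univ.map Function.Embedding.inl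

theorem postSet_mem {T₀ : ℕ} (T₁ : ℕ) (E : Finset (Fin T₀)) :
    postSet T₁ E ∈ combinations T₁ E := by
  simp [combinations, postSet, Finset.mem_powersetCard]

/-- All combinations have `T₁` elements, so the averages share the positive factor `1 / T₁`, which
cancels from every comparison. -/
theorem pValue_eq {T₀ T₁ : ℕ} (hT₁ : 0 < T₁) (E : Finset (Fin T₀)) (ρ : Fin T₁ ⊕ Blank E → ℝ) :
    pValue E ρ = (rankIn (combinations T₁ E) (absSum ρ) (postSet T₁ E) : ℝ)
      / ((combinations T₁ E).card : ℝ) := by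
  have hpos : (0 : ℝ) < 1 / (T₁ : ℝ) := by positivity
  unfold pValue rankIn
  rw [one_div, div_eq_inv_mul, Finset.card_filter, Nat.cast_sum]
  congr 1
  refine Finset.sum_congr rfl fun π hπ => ?_
  have hcard : π.card = T₁ := (Finset.mem_powersetCard.1 hπ).2
  have h1 : testStat (fun i : π => ρ i.1) = 1 / (T₁ : ℝ) * absSum ρ π := by
    unfold testStat absSum
    rw [Fintype.card_coe, hcard, Finset.sum_coe_sort π fun i => |ρ i|]
  have h2 : testStat (fun t : Fin T₁ => ρ (Sum.inl t))
      = 1 / (T₁ : ℝ) * absSum ρ (postSet T₁ E) := by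
    unfold testStat absSum postSet
    rw [Fintype.card_fin, Finset.sum_map]; rfl
  have hiff : testStat (fun i : π => ρ i.1) ≥ testStat (fun t : Fin T₁ => ρ (Sum.inl t))
      ↔ absSum ρ (postSet T₁ E) ≤ absSum ρ π := by
    rw [h1, h2, ge_iff_le, mul_le_mul_iff_right₀ hpos]
  by_cases h : absSum ρ (postSet T₁ E) ≤ absSum ρ π
  · rw [Set.indicator_of_mem (by exact hiff.2 h), if_pos h, Nat.cast_one]
  · rw [Set.indicator_of_notMem (by exact fun h' => h (hiff.1 h')), if_neg h, Nat.cast_zero]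

/-- The values of `g` at distinct elements of `s` differ by more than `c`. -/
def Separated {α : Type*} (s : Finset α) (c : ℝ) (g : α → ℝ) : Prop :=
  ∀ a ∈ s, ∀ b ∈ s, a ≠ b → c < |g a - g b|

theorem Separated.injOn {α : Type*} {s : Finset α} {c : ℝ} {g : α → ℝ} (hc : 0 ≤ c)
    (h : Separated s c g) : Set.InjOn g s := by
  intro a ha b hb hab
  by_contra hne
  have := h a ha b hb hne
  rw [hab, sub_self, abs_zero] at this
  exact absurd this hc.not_gt

/-- Perturbations smaller than half of the separation do not change ranks. -/
theorem Separated.rankIn_eq {α : Type*} {s : Finset α} {c : ℝ} {g g' : α → ℝ}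
    (h : Separated s (2 * c) g) (hgg' : ∀ a ∈ s, |g' a - g a| ≤ c) {a : α} (ha : a ∈ s) :
    rankIn s g' a = rankIn s g a := by
  unfold rankIn
  congr 1
  refine Finset.filter_congr fun b hb => ?_
  by_cases hab : a = b
  · subst hab; simp
  have h1 := abs_le.1 (hgg' a ha)
  have h2 := abs_le.1 (hgg' b hb)
  rcases lt_abs.1 (h a ha b hb hab) with h3 | h3
  · constructor <;> intro h4 <;> linarith
  · constructor <;> intro h4 <;> linarith

theorem abs_absSum_sub_le {ι : Type*} {ρ ρ' : ι → ℝ} {δ : ℝ} (h : ∀ i, |ρ' i - ρ i| ≤ δ)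
    (π : Finset ι) : |absSum ρ' π - absSum ρ π| ≤ π.card * δ := by
  unfold absSum
  rw [← Finset.sum_sub_distrib, ← nsmul_eq_mul]
  refine (Finset.abs_sum_le_sum_abs _ _).trans (Finset.sum_le_card_nsmul _ _ _ fun i _ => ?_)
  exact (abs_abs_sub_abs_le _ _).trans (h i)

theorem absSum_comp_perm {ι : Type*} (ρ : ι → ℝ) (σ : Equiv.Perm ι) (π : Finset ι) :
    absSum (fun i => ρ (σ i)) π = absSum ρ (π.map σ.toEmbedding) := by
  simp [absSum, Finset.sum_map]

/-- Transitivity of the symmetric group on combinations is what makes all combinations equivalent in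
law. -/
theorem exists_perm_map_eq {ι : Type*} [Finite ι] {π π' : Finset ι} (h : π.card = π'.card) :
    ∃ σ : Equiv.Perm ι, π.map σ.toEmbedding = π' := by
  classical
  let e : {i // i ∈ π} ≃ {i // i ∈ π'} := Fintype.equivOfCardEq (by simpa using h)
  refine ⟨e.extendSubtype, Finset.eq_of_subset_of_card_le (fun i hi => ?_) ?_⟩
  · obtain ⟨k, hk, rfl⟩ := Finset.mem_map.1 hi
    exact e.extendSubtype_mem k hk
  · rw [Finset.card_map, h]

/-! ### Anti-concentration -/

/-- A uniform bound on the slices in direction `k` bounds the measure of a set. -/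
theorem pi_le_of_forall_slice_le {K : Type*} [Fintype K] [DecidableEq K] (μ : K → Measure ℝ)
    [∀ k, IsProbabilityMeasure (μ k)] {A : Set (K → ℝ)} (hA : MeasurableSet A) (k : K) {L : ℝ≥0∞}
    (h : ∀ s, μ k {x | Function.update s k x ∈ A} ≤ L) : Measure.pi μ A ≤ L := by
  have hle : ∫⁻ s, A.indicator 1 s ∂Measure.pi μ ≤ ∫⁻ _, L ∂Measure.pi μ := by
    refine lintegral_le_of_lmarginal_le {k} (measurable_one.indicator hA) measurable_const ?_
    rw [lmarginal_singleton, lmarginal_singleton]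
    intro s
    have hs : MeasurableSet {x | Function.update s k x ∈ A} := measurable_update s hA
    have h1 : (fun x => A.indicator (1 : (K → ℝ) → ℝ≥0∞) (Function.update s k x))
        = {x | Function.update s k x ∈ A}.indicator 1 := by
      ext x; simp [Set.indicator]
    simpa [h1, lintegral_indicator_one hs] using h s
  rwa [lintegral_indicator_one hA, lintegral_const, measure_univ, mul_one] at hle

theorem volume_affine_mem_Icc_le {c : ℝ} (hc : c ≠ 0) (β p q : ℝ) :
    volume {x : ℝ | c * x + β ∈ Set.Icc p q} = ENNReal.ofReal ((q - p) / |c|) := by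
  have : {x : ℝ | c * x + β ∈ Set.Icc p q} = (c * ·) ⁻¹' Set.Icc (p - β) (q - β) := by
    ext x; simp only [Set.mem_ofPred_eq, Set.mem_Icc, Set.mem_preimage]
    constructor <;> rintro ⟨h1, h2⟩ <;> constructor <;> linarith
  rw [this, Real.volume_preimage_mul_left hc, Real.volume_Icc, ← ENNReal.ofReal_mul (abs_nonneg _),
    abs_inv]
  congr 1
  rw [sub_sub_sub_cancel_right]
  ring

/-- The condition confines `c * x + β` to one of two intervals of length `2 * b`, centred at `-γ`
and `γ`, according to its sign. -/
theorem volume_abs_affine_le {c : ℝ} (hc : c ≠ 0) (β γ : ℝ) {b : ℝ} (hb : 0 ≤ b) :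
    volume {x : ℝ | |(|c * x + β|) + γ| ≤ b} ≤ ENNReal.ofReal (4 * b / |c|) := by
  have hsub : {x : ℝ | |(|c * x + β|) + γ| ≤ b}
      ⊆ {x | c * x + β ∈ Set.Icc (-γ - b) (-γ + b)} ∪ {x | c * x + β ∈ Set.Icc (γ - b) (γ + b)} := by
    intro x hx
    have hx := abs_le.1 (show |(|c * x + β|) + γ| ≤ b from hx)
    rcases le_total 0 (c * x + β) with h | h
    · left
      rw [abs_of_nonneg h] at hx
      constructor <;> linarith [hx.1, hx.2]
    · right
      rw [abs_of_nonpos h] at hx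
      constructor <;> linarith [hx.1, hx.2]
  refine (measure_mono hsub).trans ((measure_union_le _ _).trans ?_)
  rw [volume_affine_mem_Icc_le hc, volume_affine_mem_Icc_le hc, ← ENNReal.ofReal_add
    (by ring_nf; positivity) (by ring_nf; positivity)]
  apply ENNReal.ofReal_le_ofReal
  apply le_of_eq
  ring

/-- The linear combinations with coefficients `c` of the rows of an array. -/
def combine {ι : Type*} {J : ℕ} (c : Fin J → ℝ) (s : ι × Fin J → ℝ) (i : ι) : ℝ :=
  ∑ j, c j * s (i, j)

theorem measurable_absSum_combine_right {ι : Type*} {J : ℕ} (c : Fin J → ℝ) (π : Finset ι) :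
    Measurable fun s : ι × Fin J → ℝ => absSum (combine c s) π := by
  unfold absSum combine; fun_prop

theorem combine_update_same {ι : Type*} [DecidableEq ι] {J : ℕ} (c : Fin J → ℝ)
    (s : ι × Fin J → ℝ) (i : ι) (j : Fin J) (x : ℝ) :
    combine c (Function.update s (i, j) x) i
      = c j * x + ∑ j' ∈ Finset.univ.erase j, c j' * s (i, j') := by
  unfold combine
  rw [← Finset.add_sum_erase _ _ (Finset.mem_univ j), Function.update_self]
  congr 1
  refine Finset.sum_congr rfl fun j' hj' => ?_
  rw [Function.update_of_ne]
  exact fun h => (Finset.mem_erase.1 hj').1 (Prod.ext_iff.1 h).2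

theorem combine_update_of_ne {ι : Type*} [DecidableEq ι] {J : ℕ} (c : Fin J → ℝ)
    (s : ι × Fin J → ℝ) {i i' : ι} (h : i' ≠ i) (j : Fin J) (x : ℝ) :
    combine c (Function.update s (i, j) x) i' = combine c s i' := by
  unfold combine
  refine Finset.sum_congr rfl fun j' _ => ?_
  rw [Function.update_of_ne]
  exact fun h' => h (Prod.ext_iff.1 h').1

/-- Choose a row `i` in `π` but not in `π'` and vary only the entry `(i, j)`. A single term moves,
the absolute value of an affine function with slope `c j`, so the bad values of the entry form a set
of length at most `4 * b / a`. -/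
theorem pi_absSum_sub_le {ι : Type*} [Fintype ι] [DecidableEq ι] {J : ℕ} {ν : Measure ℝ}
    [IsProbabilityMeasure ν] {κ : ℝ} (hκ : 0 ≤ κ)
    (hν : ∀ A, MeasurableSet A → ν A ≤ ENNReal.ofReal κ * volume A)
    {c : Fin J → ℝ} {j : Fin J} {a : ℝ} (ha : 0 < a) (hc : a ≤ |c j|) {π π' : Finset ι}
    (hne : ¬ π ⊆ π') {b : ℝ} (hb : 0 ≤ b) :
    Measure.pi (fun _ : ι × Fin J => ν)
      {s | |absSum (combine c s) π - absSum (combine c s) π'| ≤ b}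
      ≤ ENNReal.ofReal (κ * (4 * b / a)) := by
  obtain ⟨i, hi, hi'⟩ := Finset.not_subset.1 hne
  have hm := measurable_absSum_combine_right (ι := ι) c
  have hmeas : MeasurableSet {s : ι × Fin J → ℝ |
      |absSum (combine c s) π - absSum (combine c s) π'| ≤ b} :=
    measurableSet_le ((hm π).sub (hm π')).abs measurable_const
  refine pi_le_of_forall_slice_le _ hmeas (i, j) fun s => ?_
  have hset : Function.update s (i, j) ⁻¹' {s : ι × Fin J → ℝ |
        |absSum (combine c s) π - absSum (combine c s) π'| ≤ b}
      = {x | |(|c j * x + ∑ j' ∈ Finset.univ.erase j, c j' * s (i, j')|)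
        + (absSum (combine c s) (π.erase i) - absSum (combine c s) π')| ≤ b} := by
    ext x
    have h1 : absSum (combine c (Function.update s (i, j) x)) π
        = |c j * x + ∑ j' ∈ Finset.univ.erase j, c j' * s (i, j')|
          + absSum (combine c s) (π.erase i) := by
      unfold absSum
      rw [← Finset.add_sum_erase _ _ hi, combine_update_same]
      congr 1
      exact Finset.sum_congr rfl fun i' hi' => by
        rw [combine_update_of_ne _ _ (Finset.mem_erase.1 hi').1]
    have h2 : absSum (combine c (Function.update s (i, j) x)) π' = absSum (combine c s) π' := by
      unfold absSum
      exact Finset.sum_congr rfl fun k hk => by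
        rw [combine_update_of_ne _ _ (ne_of_mem_of_not_mem hk hi')]
    simp only [Set.mem_preimage, Set.mem_ofPred_eq, h1, h2, add_sub_assoc]
  have hcj : c j ≠ 0 := abs_pos.1 (ha.trans_le hc)
  refine (hν _ (measurable_update s hmeas)).trans ?_
  rw [hset, ENNReal.ofReal_mul hκ]
  gcongr
  refine (volume_abs_affine_le hcj _ _ hb).trans (ENNReal.ofReal_le_ofReal ?_)
  gcongr

/-- A union bound over unordered pairs. -/
theorem two_mul_measure_not_separated_le {α X : Type*} [MeasurableSpace X] (m : Measure X)
    (s : Finset α) (b : ℝ) (G : X → α → ℝ) (L : ℝ≥0∞)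
    (h : ∀ a ∈ s, ∀ a' ∈ s, a ≠ a' → m {x | |G x a - G x a'| ≤ b} ≤ L) :
    2 * m {x | ¬ Separated s b (G x)} ≤ (s.card : ℝ≥0∞) ^ 2 * L := by
  classical
  -- An arbitrary order picks one representative of each unordered pair, at most `s.card ^ 2 / 2` in
  -- all; this saves a factor 2.
  let _ : LinearOrder α := linearOrderOfSTO (WellOrderingRel (α := α))
  let p : Finset (α × α) := (s ×ˢ s).filter fun q => q.1 < q.2
  let p' : Finset (α × α) := (s ×ˢ s).filter fun q => q.2 < q.1
  have hp : ∀ q ∈ p, q.1 ∈ s ∧ q.2 ∈ s ∧ q.1 ≠ q.2 := fun q hq => by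
    simp only [p, Finset.mem_filter, Finset.mem_product] at hq
    exact ⟨hq.1.1, hq.1.2, hq.2.ne⟩
  have hpp' : p'.card = p.card := by
    refine Finset.card_nbij' Prod.swap Prod.swap ?_ ?_ (fun _ _ => rfl) (fun _ _ => rfl) <;>
    · intro q hq
      simp only [p, p', Finset.coe_filter, Finset.mem_product, Set.mem_ofPred_eq, Prod.fst_swap,
        Prod.snd_swap] at hq ⊢
      exact ⟨⟨hq.1.2, hq.1.1⟩, hq.2⟩
  have hcard : 2 * p.card ≤ s.card ^ 2 := by
    have hdisj : Disjoint p p' := Finset.disjoint_filter.2 fun q _ h1 h2 => lt_asymm h1 h2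
    have : (p ∪ p').card ≤ (s ×ˢ s).card :=
      Finset.card_le_card (Finset.union_subset (Finset.filter_subset _ _) (Finset.filter_subset _ _))
    rw [Finset.card_union_of_disjoint hdisj, hpp', Finset.card_product] at this
    rw [sq]; omega
  have hsub : {x | ¬ Separated s b (G x)} ⊆ ⋃ q ∈ p, {x | |G x q.1 - G x q.2| ≤ b} := by
    intro x hx
    simp only [Separated, Set.mem_ofPred_eq, not_forall, not_lt] at hx
    obtain ⟨a, ha, a', ha', hne, hx⟩ := hx
    simp only [Set.mem_iUnion, Set.mem_ofPred_eq]
    rcases lt_or_gt_of_ne hne with hlt | hlt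
    · exact ⟨(a, a'), by simp [p, ha, ha', hlt], hx⟩
    · exact ⟨(a', a), by simp [p, ha, ha', hlt], by rwa [abs_sub_comm]⟩
  calc 2 * m {x | ¬ Separated s b (G x)}
      ≤ 2 * ∑ q ∈ p, m {x | |G x q.1 - G x q.2| ≤ b} := by
        gcongr
        exact (measure_mono hsub).trans (measure_biUnion_finset_le _ _)
    _ ≤ 2 * (p.card • L) := by
        gcongr
        exact Finset.sum_le_card_nsmul _ _ _ fun q hq =>
          h _ (hp q hq).1 _ (hp q hq).2.1 (hp q hq).2.2
    _ = ((2 * p.card : ℕ) : ℝ≥0∞) * L := by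
        rw [nsmul_eq_mul]; push_cast; ring
    _ ≤ ((s.card ^ 2 : ℕ) : ℝ≥0∞) * L := by gcongr
    _ = (s.card : ℝ≥0∞) ^ 2 * L := by push_cast; rfl

/-- Weight vectors with disjoint supports that sum to one differ by at least `2 / J` somewhere. -/
theorem exists_two_div_le_abs_sub {J : ℕ} {w v : Fin J → ℝ} (hw : ∑ j, w j = 1)
    (hv : ∑ j, v j = 1) (hw0 : ∀ j, 0 ≤ w j) (hv0 : ∀ j, 0 ≤ v j) (hwv : ∀ j, w j * v j = 0) :
    ∃ j, 2 / (J : ℝ) ≤ |w j - v j| := by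
  by_contra! hlt
  have hJ : Nonempty (Fin J) := by
    by_contra hJ
    rw [not_nonempty_iff] at hJ
    simp at hw
  have hJ0 : 0 < (J : ℝ) := by
    have := Fin.pos_iff_nonempty.2 hJ
    exact_mod_cast this
  -- Disjoint supports prevent cancellation, so `|w j - v j| = w j + v j`; if every term were below
  -- `2 / J` the total would be below 2.
  have h1 : ∑ j, |w j - v j| = 2 := by
    have : ∀ j, |w j - v j| = w j + v j := fun j => by
      rcases mul_eq_zero.1 (hwv j) with h | h
      · rw [h, zero_sub, abs_neg, abs_of_nonneg (hv0 j), zero_add]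
      · rw [h, sub_zero, abs_of_nonneg (hw0 j), add_zero]
    rw [Finset.sum_congr rfl fun j _ => this j, Finset.sum_add_distrib, hw, hv]
    norm_num
  have h2 : ∑ j : Fin J, |w j - v j| < ∑ _j : Fin J, 2 / (J : ℝ) :=
    Finset.sum_lt_sum_of_nonempty Finset.univ_nonempty fun j _ => hlt j
  rw [h1, Finset.sum_const, Finset.card_univ, Fintype.card_fin, nsmul_eq_mul,
    mul_div_cancel₀ _ hJ0.ne'] at h2
  exact lt_irrefl _ h2

/-! ### Exchangeability -/

/-- The coefficients `w - v` of the units in the synthetic difference. -/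
def weightDiff {J : ℕ} (W : (Fin J → ℝ) × (Fin J → ℝ)) (j : Fin J) : ℝ := W.1 j - W.2 j

theorem measurable_weightDiff {J : ℕ} : Measurable (weightDiff (J := J)) := by
  unfold weightDiff; fun_prop

theorem measurable_absSum_combine_weightDiff {ι : Type*} {J : ℕ} (π : Finset ι) :
    Measurable fun p : ((Fin J → ℝ) × (Fin J → ℝ)) × (ι × Fin J → ℝ) =>
      absSum (combine (weightDiff p.1) p.2) π := by
  unfold absSum combine weightDiff; fun_prop

theorem measurableSet_separated {α X : Type*} [MeasurableSpace X] (s : Finset α) (b : ℝ)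
    {G : X → α → ℝ} (hG : ∀ a, Measurable fun x => G x a) :
    MeasurableSet {x | Separated s b (G x)} := by
  have : {x | Separated s b (G x)}
      = ⋂ a ∈ s, ⋂ a' ∈ s, {x | a ≠ a' → b < |G x a - G x a'|} := by
    ext x; simp [Separated]
  rw [this]
  refine Finset.measurableSet_biInter _ fun a _ => Finset.measurableSet_biInter _ fun a' _ => ?_
  by_cases h : a = a'
  · simp [h]
  · simpa [h] using measurableSet_lt measurable_const ((hG a).sub (hG a')).abs

theorem measurable_rankIn {α X : Type*} [MeasurableSpace X] (s : Finset α)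
    {G : X → α → ℝ} (hG : ∀ a, Measurable fun x => G x a) (a : α) :
    Measurable fun x => rankIn s (G x) a := by
  classical
  simp only [rankIn, Finset.card_filter]
  exact Finset.measurable_sum _ fun b _ =>
    Measurable.ite (measurableSet_le (hG a) (hG b)) measurable_const measurable_const

theorem rankIn_comp {α : Type*} {s : Finset α} {g : α → ℝ} (τ : Equiv.Perm α)
    (hτ : ∀ a, τ a ∈ s ↔ a ∈ s) (a : α) : rankIn s (fun b => g (τ b)) a = rankIn s g (τ a) := by
  unfold rankIn
  refine Finset.card_nbij' τ τ.symm ?_ ?_ (fun _ _ => by simp) (fun _ _ => by simp)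
  · intro b hb
    simpa [hτ] using hb
  · intro b hb
    have := hτ (τ.symm b)
    simp only [Equiv.apply_symm_apply] at this
    simpa [← this] using hb

theorem Separated.comp {α : Type*} {s : Finset α} {b : ℝ} {g : α → ℝ} (τ : Equiv.Perm α)
    (hτ : ∀ a, τ a ∈ s ↔ a ∈ s) (h : Separated s b g) : Separated s b fun a => g (τ a) :=
  fun a ha a' ha' hne => h _ ((hτ a).2 ha) _ ((hτ a').2 ha') fun h' => hne (τ.injective h')

theorem mem_powersetCard_map_perm {ι : Type*} [Fintype ι] (n : ℕ) (σ : Equiv.Perm ι)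
    (π : Finset ι) : σ.finsetCongr π ∈ Finset.powersetCard n Finset.univ
      ↔ π ∈ Finset.powersetCard n Finset.univ := by
  simp [Finset.mem_powersetCard]

theorem absSum_combine_comp_perm {ι : Type*} {J : ℕ} (c : Fin J → ℝ) (s : ι × Fin J → ℝ)
    (σ : Equiv.Perm ι) (π : Finset ι) :
    absSum (combine c fun k => s (σ k.1, k.2)) π = absSum (combine c s) (σ.finsetCongr π) :=
  absSum_comp_perm (combine c s) σ π

/-- Permuting the rows of an array of independent identically distributed entries preserves its
law. -/
theorem measurePreserving_permute {ι : Type*} [Fintype ι] {J : ℕ} {X : Type*} [MeasurableSpace X]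
    (Q : Measure X) [IsProbabilityMeasure Q] (ν : Measure ℝ) [IsProbabilityMeasure ν]
    (σ : Equiv.Perm ι) :
    MeasurePreserving (fun p : X × (ι × Fin J → ℝ) => (p.1, fun k : ι × Fin J => p.2 (σ k.1, k.2)))
      (Q.prod (Measure.pi fun _ => ν)) (Q.prod (Measure.pi fun _ => ν)) := by
  -- Transport along an equivalence precomposes with its inverse, hence `σ.symm`.
  have h := measurePreserving_arrowCongr' (fun _ : ι × Fin J => ν) (fun _ : ι × Fin J => ν)
    (σ.symm.prodCongr (Equiv.refl (Fin J))) (MeasurableEquiv.refl ℝ)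
    fun _ => MeasurePreserving.id ν
  exact (MeasurePreserving.id Q).prod h

/-- Conditionally on the weights and on a separation event, the rank of the statistic of a given
combination is uniformly distributed. -/
theorem card_mul_measure_rankIn_le {ι : Type*} [Fintype ι] {J : ℕ}
    (Q : Measure ((Fin J → ℝ) × (Fin J → ℝ))) [IsProbabilityMeasure Q] (ν : Measure ℝ)
    [IsProbabilityMeasure ν] {D : Set ((Fin J → ℝ) × (Fin J → ℝ))} (hD : MeasurableSet D)
    {n : ℕ} {b : ℝ} (hb : 0 ≤ b) {π₀ : Finset ι} (hπ₀ : π₀ ∈ Finset.powersetCard n Finset.univ)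
    {m : ℕ} (hm : m ≤ (Finset.powersetCard n (Finset.univ : Finset ι)).card) :
    ((Finset.powersetCard n (Finset.univ : Finset ι)).card : ℝ≥0∞) *
        (Q.prod (Measure.pi fun _ : ι × Fin J => ν))
          {p | (p.1 ∈ D ∧ Separated (Finset.powersetCard n Finset.univ) b
              (absSum (combine (weightDiff p.1) p.2))) ∧
            rankIn (Finset.powersetCard n Finset.univ)
              (absSum (combine (weightDiff p.1) p.2)) π₀ ≤ m}
      = m * (Q.prod (Measure.pi fun _ : ι × Fin J => ν))
          {p | p.1 ∈ D ∧ Separated (Finset.powersetCard n Finset.univ) b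
              (absSum (combine (weightDiff p.1) p.2))} := by
  classical
  set s : Finset (Finset ι) := Finset.powersetCard n Finset.univ with hs
  set μ := Q.prod (Measure.pi fun _ : ι × Fin J => ν)
  let G : ((Fin J → ℝ) × (Fin J → ℝ)) × (ι × Fin J → ℝ) → Finset ι → ℝ :=
    fun p => absSum (combine (weightDiff p.1) p.2)
  have hG : ∀ π, Measurable fun p => G p π := measurable_absSum_combine_weightDiff
  let A := {p : ((Fin J → ℝ) × (Fin J → ℝ)) × (ι × Fin J → ℝ) | p.1 ∈ D ∧ Separated s b (G p)}
  let B := fun π => {p | p ∈ A ∧ rankIn s (G p) π ≤ m}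
  have hA : MeasurableSet A := (measurable_fst hD).inter (measurableSet_separated s b hG)
  have hB : ∀ π, MeasurableSet (B π) := fun π =>
    hA.inter (measurableSet_le (measurable_rankIn s hG π) measurable_const)
  -- A row permutation taking `π₀` to `π` preserves `μ`. It fixes `A`, since `D` constrains only the
  -- weights and separation is symmetric in the combinations, and it turns the rank of `π₀` into
  -- that of `π`.
  have hsymm : ∀ π ∈ s, μ (B π) = μ (B π₀) := by
    intro π hπ
    obtain ⟨σ, hσ⟩ := exists_perm_map_eq (π := π₀) (π' := π)
      ((Finset.mem_powersetCard.1 hπ₀).2.trans (Finset.mem_powersetCard.1 hπ).2.symm)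
    have hmp := measurePreserving_permute (J := J) Q ν σ
    rw [← hmp.measure_preimage (hB π₀).nullMeasurableSet]
    congr 1
    have hGσ : ∀ p : ((Fin J → ℝ) × (Fin J → ℝ)) × (ι × Fin J → ℝ),
        G (p.1, fun k : ι × Fin J => p.2 (σ k.1, k.2)) = fun π => G p (σ.finsetCongr π) :=
      fun p => funext fun π => absSum_combine_comp_perm _ _ σ π
    have hτ := mem_powersetCard_map_perm n σ
    have hτ' : ∀ π, σ.finsetCongr.symm π ∈ s ↔ π ∈ s := fun π => by
      have := hτ (σ.finsetCongr.symm π)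
      rw [Equiv.apply_symm_apply] at this
      exact this.symm
    ext p
    simp only [B, A, Set.mem_preimage, Set.mem_ofPred_eq, hGσ]
    rw [rankIn_comp σ.finsetCongr hτ, show σ.finsetCongr π₀ = π from hσ]
    have : Separated s b (G p) ↔ Separated s b fun π => G p (σ.finsetCongr π) :=
      ⟨Separated.comp _ hτ, fun h => by
        simpa only [Equiv.apply_symm_apply] using h.comp σ.finsetCongr.symm hτ'⟩
    rw [this]
  -- On `A` there are no ties, so exactly `m` combinations have rank at most `m`; integrating gives
  -- the sum of all `μ (B π)`.
  have hcount : ∀ p, ∑ π ∈ s, (B π).indicator (fun _ => (1 : ℝ≥0∞)) p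
      = A.indicator (fun _ => (m : ℝ≥0∞)) p := by
    intro p
    by_cases hp : p ∈ A
    · rw [Set.indicator_of_mem hp, ← card_filter_rankIn_le (hp.2.injOn hb) hm, Finset.card_filter,
        Nat.cast_sum]
      refine Finset.sum_congr rfl fun π _ => ?_
      by_cases h : rankIn s (G p) π ≤ m
      · rw [Set.indicator_of_mem (show p ∈ B π from ⟨hp, h⟩), if_pos h]; simp
      · rw [Set.indicator_of_notMem (fun h' : p ∈ B π => h h'.2), if_neg h]; simp
    · rw [Set.indicator_of_notMem hp]
      exact Finset.sum_eq_zero fun π _ => Set.indicator_of_notMem (fun h' : p ∈ B π => hp h'.1) _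
  calc (s.card : ℝ≥0∞) * μ (B π₀) = ∑ π ∈ s, μ (B π) := by
        rw [Finset.sum_congr rfl hsymm, Finset.sum_const, nsmul_eq_mul]
    _ = ∑ π ∈ s, ∫⁻ p, (B π).indicator (fun _ => 1) p ∂μ := by
        exact Finset.sum_congr rfl fun π _ => (lintegral_indicator_one (hB π)).symm
    _ = ∫⁻ p, ∑ π ∈ s, (B π).indicator (fun _ => 1) p ∂μ :=
        (lintegral_finsetSum _ fun π _ => measurable_const.indicator (hB π)).symm
    _ = m * μ A := by
        simp_rw [hcount]
        rw [lintegral_indicator hA, setLIntegral_const]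

/-! ### The joint law of the weights and the shocks outside the fitting periods -/

/-- The period of a coordinate of `r̂`. -/
def indexPeriod {T₀ T₁ : ℕ} {E : Finset (Fin T₀)} : Fin T₁ ⊕ Blank E → Period T₀ T₁
  | Sum.inl t => Sum.inr t
  | Sum.inr s => Sum.inl s.1

theorem indexPeriod_injective {T₀ T₁ : ℕ} {E : Finset (Fin T₀)} :
    Function.Injective (indexPeriod : Fin T₁ ⊕ Blank E → Period T₀ T₁) := by
  rintro (t | s) (t' | s') h <;> simp_all [indexPeriod, Subtype.ext_iff]

theorem indexPeriod_mem {T₀ T₁ : ℕ} {E : Finset (Fin T₀)} (i : Fin T₁ ⊕ Blank E) :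
    indexPeriod i ∈ nonFitting T₁ E := by
  rcases i with t | s
  · intro s _; simp [indexPeriod]
  · intro s' hs' h
    have : s.1 = s' := by simpa [indexPeriod] using h
    exact s.2 (this ▸ hs')

/-- The shock relevant for the observed outcome: `ξ` for a treated unit in a post-intervention period
and `ε` otherwise. -/
noncomputable def selectShock {ι κ : Type*} {J : ℕ} (W : (Fin J → ℝ) × (Fin J → ℝ))
    (k : (ι ⊕ κ) × Fin J) (x : ℝ × ℝ) : ℝ :=
  if k.1.isLeft = true ∧ 0 < W.1 k.2 then x.2 else x.1

theorem measurable_selectShock {ι κ : Type*} {J : ℕ} (k : (ι ⊕ κ) × Fin J) :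
    Measurable fun p : ((Fin J → ℝ) × (Fin J → ℝ)) × (ℝ × ℝ) => selectShock p.1 k p.2 := by
  unfold selectShock
  refine Measurable.ite ?_ (by fun_prop) (by fun_prop)
  by_cases h : k.1.isLeft = true
  · simp only [h, true_and]
    exact measurableSet_lt measurable_const (by fun_prop)
  · simp [h]

theorem measurable_selectShock_right {ι κ : Type*} {J : ℕ} (W : (Fin J → ℝ) × (Fin J → ℝ))
    (k : (ι ⊕ κ) × Fin J) : Measurable (selectShock W k) := by
  unfold selectShock
  split_ifs <;> fun_prop

namespace FactorModel

variable {J T₀ T₁ r F : ℕ} {Ω : Type*} (M : FactorModel J T₀ T₁ r F Ω)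

/-- The shocks of all units outside the fitting periods. -/
def noise (E : Finset (Fin T₀)) (ω : Ω) (k : (Fin T₁ ⊕ Blank E) × Fin J) : ℝ × ℝ :=
  M.shocks k.2 (indexPeriod k.1) ω

/-- The difference between the treated and the control averages of the unobserved covariates. -/
def imbalance (W : (Fin J → ℝ) × (Fin J → ℝ)) : Fin F → ℝ := ∑ j, weightDiff W j • M.mu j

theorem measurable_imbalance : Measurable M.imbalance := by
  unfold imbalance weightDiff; fun_prop

/-- Time effects and observed covariates cancel in balanced differences. -/
theorem sum_weightDiff_mul {W : (Fin J → ℝ) × (Fin J → ℝ)} (hW : ∑ j, weightDiff W j = 0)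
    (hZ : ∑ j, weightDiff W j • M.Z j = 0) (t : Period T₀ T₁) (e : Fin J → ℝ) :
    ∑ j, weightDiff W j * (M.delta t + M.theta t ⬝ᵥ M.Z j + M.lam t ⬝ᵥ M.mu j + e j)
      = M.lam t ⬝ᵥ M.imbalance W + ∑ j, weightDiff W j * e j := by
  have h1 : ∑ j, weightDiff W j * (M.theta t ⬝ᵥ M.Z j) = 0 := by
    have : M.theta t ⬝ᵥ ∑ j, weightDiff W j • M.Z j = 0 := by rw [hZ, dotProduct_zero]
    simpa [dotProduct_sum, dotProduct_smul] using this
  have h2 : M.lam t ⬝ᵥ M.imbalance W = ∑ j, weightDiff W j * (M.lam t ⬝ᵥ M.mu j) := by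
    simp [imbalance, dotProduct_sum, dotProduct_smul]
  simp only [mul_add, Finset.sum_add_distrib, ← Finset.sum_mul, hW, h1, h2]
  ring

/-- Under the null, treatment only selects which shock enters, so all units share one form of
systematic part, of which balanced weights leave only the factor term. The first summand is the
exchangeable noise, the second the perturbation to be controlled. -/
theorem rhat_eq [MeasurableSpace Ω] {P : Measure Ω} (hnull : M.NullHypothesis P)
    {E : Finset (Fin T₀)} {w v : Ω → Fin J → ℝ} {ω : Ω}
    (hW : ∑ j, weightDiff (w ω, v ω) j = 0) (hZ : ∑ j, weightDiff (w ω, v ω) j • M.Z j = 0)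
    (i : Fin T₁ ⊕ Blank E) :
    M.rhat E w v ω i
      = combine (weightDiff (w ω, v ω)) (fun k => selectShock (w ω, v ω) k (M.noise E ω k)) i
        + M.lam (indexPeriod i) ⬝ᵥ M.imbalance (w ω, v ω) := by
  have key : M.rhat E w v ω i = ∑ j, weightDiff (w ω, v ω) j *
      (M.delta (indexPeriod i) + M.theta (indexPeriod i) ⬝ᵥ M.Z j
        + M.lam (indexPeriod i) ⬝ᵥ M.mu j
        + selectShock (w ω, v ω) (i, j) (M.noise E ω (i, j))) := by
    rcases i with t | s
    · simp only [rhat, effect, ← Finset.sum_sub_distrib]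
      refine Finset.sum_congr rfl fun j _ => ?_
      by_cases h : 0 < w ω j
      · simp only [Y, if_pos h, (hnull j t).1 ω, indexPeriod, selectShock, noise, shocks,
          Sum.isLeft_inl, true_and, weightDiff]
        ring
      · simp only [Y, if_neg h, YN, indexPeriod, selectShock, noise, shocks,
          Sum.isLeft_inl, true_and, weightDiff]
        ring
    · simp only [rhat, effect, ← Finset.sum_sub_distrib]
      refine Finset.sum_congr rfl fun j _ => ?_
      simp only [Y, YN, indexPeriod, selectShock, noise, shocks, weightDiff, Sum.isLeft_inr,
        Bool.false_eq_true, false_and, if_false]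
      ring
  rw [key, M.sum_weightDiff_mul hW hZ, add_comm]
  rfl

variable [MeasurableSpace Ω] {P : Measure Ω}

theorem measurable_shocks (heps : ∀ j t, Measurable (M.eps j t)) (hxi : ∀ j t, Measurable (M.xi j t))
    (j : Fin J) (t : Period T₀ T₁) : Measurable (M.shocks j t) := by
  rcases t with s | t
  · exact (heps j _).prodMk measurable_const
  · exact (heps j _).prodMk (hxi j t)

theorem measurable_predictors (heps : ∀ j t, Measurable (M.eps j t)) (E : Finset (Fin T₀)) :
    Measurable (M.predictors E) := by
  refine measurable_pi_lambda _ fun j => ?_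
  refine (WithLp.measurable_toLp 2 _).comp (measurable_pi_lambda _ ?_)
  rintro (s | z)
  · exact measurable_const.add (heps j _)
  · exact measurable_const

/-- Functions of the predictors are independent of the shocks outside the fitting periods. -/
theorem indepFun_noise (heps : ∀ j t, Measurable (M.eps j t)) (hxi : ∀ j t, Measurable (M.xi j t))
    (hindep : iIndepFun (fun p : Fin J × Period T₀ T₁ => M.shocks p.1 p.2) P)
    (E : Finset (Fin T₀)) {β : Type*} [MeasurableSpace β] {W : Ω → β}
    (hW : Measurable[MeasurableSpace.comap (M.predictors E) inferInstance] W) :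
    IndepFun W (M.noise E) P := by
  classical
  -- `A` indexes the fitting-period shocks. The predictors are a function `φ` of the shocks in `A`,
  -- the noise a function `ψ` of those in `Aᶜ`.
  let A : Finset (Fin J × Period T₀ T₁) := Finset.univ.filter fun p => ∃ s ∈ E, p.2 = Sum.inl s
  have hA : ∀ p, p ∈ A ↔ ∃ s ∈ E, p.2 = Sum.inl s := by simp [A]
  have hB : ∀ k : (Fin T₁ ⊕ Blank E) × Fin J, (k.2, (indexPeriod k.1 : Period T₀ T₁)) ∈ Aᶜ := by
    intro k
    rw [Finset.mem_compl, hA]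
    rintro ⟨s, hs, h⟩
    exact indexPeriod_mem k.1 s hs h
  have h := hindep.indepFun_finset A Aᶜ disjoint_compl_right
    fun p => M.measurable_shocks heps hxi p.1 p.2
  let φ : (A → ℝ × ℝ) → Fin J → EuclideanSpace ℝ (E ⊕ Fin r) := fun x j =>
    WithLp.toLp 2 (Sum.elim (fun s : E => M.delta (Sum.inl s.1)
      + M.theta (Sum.inl s.1) ⬝ᵥ M.Z j + M.lam (Sum.inl s.1) ⬝ᵥ M.mu j
      + (x ⟨(j, Sum.inl s.1), (hA _).2 ⟨s.1, s.2, rfl⟩⟩).1) (M.Z j))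
  have hφ : Measurable φ := by
    refine measurable_pi_lambda _ fun j => ?_
    refine (WithLp.measurable_toLp 2 _).comp (measurable_pi_lambda _ ?_)
    rintro (s | z)
    · exact measurable_const.add (measurable_fst.comp (measurable_pi_apply _))
    · exact measurable_const
  let ψ : ((Aᶜ : Finset (Fin J × Period T₀ T₁)) → ℝ × ℝ) →
      ((Fin T₁ ⊕ Blank E) × Fin J → ℝ × ℝ) := fun x k => x ⟨_, hB k⟩
  have hψ : Measurable ψ := measurable_pi_lambda _ fun k => measurable_pi_apply _
  have h' : IndepFun (M.predictors E) (M.noise E) P := h.comp hφ hψ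
  rw [IndepFun_iff_Indep] at h' ⊢
  exact indep_of_indep_of_le_left h' hW.comap_le

theorem map_noise [IsProbabilityMeasure P] (heps : ∀ j t, Measurable (M.eps j t))
    (hxi : ∀ j t, Measurable (M.xi j t))
    (hindep : iIndepFun (fun p : Fin J × Period T₀ T₁ => M.shocks p.1 p.2) P)
    (E : Finset (Fin T₀)) :
    P.map (M.noise E) = Measure.pi fun k => P.map (M.shocks k.2 (indexPeriod k.1)) := by
  have hinj : Function.Injective fun k : (Fin T₁ ⊕ Blank E) × Fin J =>
      (k.2, (indexPeriod k.1 : Period T₀ T₁)) := by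
    intro k k' h
    obtain ⟨h1, h2⟩ := Prod.ext_iff.1 h
    exact Prod.ext (indexPeriod_injective h2) h1
  exact (iIndepFun_iff_map_fun_eq_pi_map
    fun k => (M.measurable_shocks heps hxi _ _).aemeasurable).1 (hindep.precomp hinj)

/-- The weights are independent of the relevant shocks outside the fitting periods, which are
independent and identically distributed. -/
theorem measurePreserving_weights_shocks [IsProbabilityMeasure P]
    (heps : ∀ j t, Measurable (M.eps j t)) (hxi : ∀ j t, Measurable (M.xi j t))
    (hindep : iIndepFun (fun p : Fin J × Period T₀ T₁ => M.shocks p.1 p.2) P)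
    (E : Finset (Fin T₀)) (hnull : M.NullHypothesis P) {ν : Measure ℝ} [IsProbabilityMeasure ν]
    (hν : ∀ j, ∀ t ∈ nonFitting T₁ E, P.map (M.eps j t) = ν)
    {W : Ω → (Fin J → ℝ) × (Fin J → ℝ)}
    (hW : Measurable[MeasurableSpace.comap (M.predictors E) inferInstance] W) :
    MeasurePreserving (fun ω => (W ω, fun k => selectShock (W ω) k (M.noise E ω k))) P
      ((P.map W).prod (Measure.pi fun _ : (Fin T₁ ⊕ Blank E) × Fin J => ν)) := by
  have hWm : Measurable W := hW.mono (M.measurable_predictors heps E).comap_le le_rfl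
  have hnm : Measurable (M.noise E) :=
    measurable_pi_lambda _ fun k => M.measurable_shocks heps hxi _ _
  have : IsProbabilityMeasure (P.map W) := Measure.isProbabilityMeasure_map hWm.aemeasurable
  have : IsProbabilityMeasure (P.map (M.noise E)) :=
    Measure.isProbabilityMeasure_map hnm.aemeasurable
  have h1 : MeasurePreserving (fun ω => (W ω, M.noise E ω)) P
      ((P.map W).prod (P.map (M.noise E))) :=
    ⟨hWm.prodMk hnm, (indepFun_iff_map_prod_eq_prod_map_map hWm.aemeasurable hnm.aemeasurable).1
      (M.indepFun_noise heps hxi hindep E hW)⟩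
  -- For fixed weights, selection acts on each coordinate separately and gives law `ν` whichever
  -- component it takes. Dependence between `ε` and `ξ` in one pair is harmless, as only one of them
  -- is kept.
  refine MeasurePreserving.comp (MeasurePreserving.skew_product
    (g := fun W (x : (Fin T₁ ⊕ Blank E) × Fin J → ℝ × ℝ) k => selectShock W k (x k))
    (MeasurePreserving.id (P.map W)) ?_ (Filter.Eventually.of_forall fun W => ?_)) h1
  · refine measurable_pi_lambda _ fun k => ?_
    exact (measurable_selectShock k).comp (g := fun p : ((Fin J → ℝ) × (Fin J → ℝ)) × (ℝ × ℝ) =>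
      selectShock p.1 k p.2) (measurable_fst.prodMk ((measurable_pi_apply k).comp measurable_snd))
  · have hmap : ∀ k : (Fin T₁ ⊕ Blank E) × Fin J,
        (P.map (M.shocks k.2 (indexPeriod k.1))).map (selectShock W k) = ν := by
      rintro ⟨i, j⟩
      rw [Measure.map_map (measurable_selectShock_right W _) (M.measurable_shocks heps hxi _ _)]
      rcases i with t | s
      · by_cases h : 0 < W.1 j
        · rw [← hν j _ (indexPeriod_mem (E := E) (Sum.inl t))]
          refine Eq.trans ?_ (hnull j t).2.map_eq
          congr 1
          ext ω
          simp [selectShock, h, shocks, indexPeriod]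
        · rw [← hν j _ (indexPeriod_mem (E := E) (Sum.inl t))]
          congr 1
          ext ω
          simp [selectShock, h, shocks, indexPeriod]
      · rw [← hν j _ (indexPeriod_mem (E := E) (Sum.inr s))]
        congr 1
    have : ∀ k : (Fin T₁ ⊕ Blank E) × Fin J, IsProbabilityMeasure
        ((P.map (M.shocks k.2 (indexPeriod k.1))).map (selectShock W k)) := fun k => by
      rw [hmap]; infer_instance
    have : ∀ k : (Fin T₁ ⊕ Blank E) × Fin J, IsProbabilityMeasure
        (P.map (M.shocks k.2 (indexPeriod k.1))) := fun k =>
      Measure.isProbabilityMeasure_map (M.measurable_shocks heps hxi _ _).aemeasurable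
    rw [M.map_noise heps hxi hindep E,
      Measure.pi_map_pi fun k => (measurable_selectShock_right W k).aemeasurable]
    simp_rw [hmap]

end FactorModel

/-! ### Loadings as combinations of the loadings of the fitting periods -/

/-- A lower bound on the eigenvalues of a symmetric matrix bounds its quadratic form. -/
theorem mul_dotProduct_le_of_le_eigenvalues {n : Type*} [Fintype n] [DecidableEq n]
    {A : Matrix n n ℝ} (hA : A.IsHermitian) {c : ℝ} (hc : ∀ i, c ≤ hA.eigenvalues i) (x : n → ℝ) :
    c * (x ⬝ᵥ x) ≤ x ⬝ᵥ A *ᵥ x := by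
  let y : EuclideanSpace ℝ n := WithLp.toLp 2 x
  let b := hA.eigenvectorBasis
  have h1 : x ⬝ᵥ x = ∑ i, inner ℝ y (b i) * inner ℝ (b i) y := by
    rw [b.sum_inner_mul_inner, EuclideanSpace.inner_eq_star_dotProduct]; simp [y]
  have h2 : x ⬝ᵥ A *ᵥ x = ∑ i, hA.eigenvalues i * (inner ℝ y (b i) * inner ℝ (b i) y) := by
    have : x ⬝ᵥ A *ᵥ x = inner ℝ y (WithLp.toLp 2 (A *ᵥ x) : EuclideanSpace ℝ n) := by
      rw [EuclideanSpace.inner_eq_star_dotProduct]; simp [y, dotProduct_comm]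
    rw [this, ← b.sum_inner_mul_inner]
    refine Finset.sum_congr rfl fun i _ => ?_
    have : inner ℝ (b i) (WithLp.toLp 2 (A *ᵥ x) : EuclideanSpace ℝ n)
        = hA.eigenvalues i * inner ℝ (b i) y := by
      have hsymm : A *ᵥ x ⬝ᵥ (b i).ofLp = x ⬝ᵥ A *ᵥ (b i).ofLp := by
        have hT : Aᵀ = A := by
          rw [← Matrix.conjTranspose_eq_transpose_of_trivial, hA.eq]
        rw [Matrix.dotProduct_mulVec, ← Matrix.mulVec_transpose, hT]
      simp only [EuclideanSpace.inner_eq_star_dotProduct, star_trivial, y]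
      rw [hsymm, hA.mulVec_eigenvectorBasis, dotProduct_smul, smul_eq_mul]
    rw [this]; ring
  rw [h1, h2, Finset.mul_sum]
  refine Finset.sum_le_sum fun i _ => ?_
  rw [real_inner_comm]
  exact mul_le_mul_of_nonneg_right (hc i) (mul_self_nonneg _)

/-- Take `a = B *ᵥ x` with `Bᵀ * B *ᵥ x = y`; coercivity makes the Gram matrix invertible. From `c *
(x ⬝ᵥ x) ≤ x ⬝ᵥ y` and Cauchy–Schwarz, `x ⬝ᵥ x ≤ n * L ^ 2 / c ^ 2`, and Cauchy–Schwarz on each row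
of `B` bounds each `a i ^ 2` by `n * L ^ 2 * (x ⬝ᵥ x)`. -/
theorem exists_transpose_mulVec_eq {m n : Type*} [Fintype m] [Fintype n] [DecidableEq n]
    {B : Matrix m n ℝ} {c : ℝ} (hc : 0 < c) (hB : ∀ x, c * (x ⬝ᵥ x) ≤ (B *ᵥ x) ⬝ᵥ (B *ᵥ x))
    {L : ℝ} (hL : ∀ i k, |B i k| ≤ L) {y : n → ℝ} (hy : ∀ k, |y k| ≤ L) :
    ∃ a : m → ℝ, a ᵥ* B = y ∧
      ∑ i, a i ^ 2 ≤ Fintype.card m * (Fintype.card n) ^ 2 * L ^ 4 / c ^ 2 := by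
  have hquad : ∀ x, x ⬝ᵥ (Bᵀ * B) *ᵥ x = (B *ᵥ x) ⬝ᵥ (B *ᵥ x) := fun x => by
    rw [← Matrix.mulVec_mulVec, Matrix.dotProduct_mulVec, Matrix.vecMul_transpose]
  have hinj : Function.Injective (Bᵀ * B).mulVecLin := by
    rw [← LinearMap.ker_eq_bot, LinearMap.ker_eq_bot']
    intro x hx
    have h := hB x
    rw [← hquad, show (Bᵀ * B) *ᵥ x = 0 from hx, dotProduct_zero] at h
    have h0 : x ⬝ᵥ x = 0 := le_antisymm (nonpos_of_mul_nonpos_right h hc)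
      (Finset.sum_nonneg fun i _ => mul_self_nonneg (x i))
    exact dotProduct_self_eq_zero.1 h0
  obtain ⟨x, hx⟩ := (LinearMap.injective_iff_surjective.1 hinj) y
  have hx : (Bᵀ * B) *ᵥ x = y := hx
  have hsq : ∀ z : n → ℝ, (∀ k, |z k| ≤ L) → z ⬝ᵥ z ≤ Fintype.card n * L ^ 2 := fun z hz => by
    rw [← nsmul_eq_mul, ← Finset.card_univ]
    refine Finset.sum_le_card_nsmul _ _ _ fun k _ => ?_
    rw [← abs_mul_abs_self, sq]
    exact mul_le_mul (hz k) (hz k) (abs_nonneg _) ((abs_nonneg _).trans (hz k))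
  have hcs : ∀ z z' : n → ℝ, (z ⬝ᵥ z') ^ 2 ≤ (z ⬝ᵥ z) * (z' ⬝ᵥ z') := fun z z' => by
    simpa [dotProduct, sq] using Finset.sum_mul_sq_le_sq_mul_sq Finset.univ z z'
  have hxx0 : 0 ≤ x ⬝ᵥ x := Finset.sum_nonneg fun i _ => mul_self_nonneg (x i)
  have hyy := hsq y hy
  have hxx : c ^ 2 * (x ⬝ᵥ x) ≤ Fintype.card n * L ^ 2 := by
    have h1 : c * (x ⬝ᵥ x) ≤ x ⬝ᵥ y := by rw [← hx, hquad]; exact hB x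
    have h2 : (c * (x ⬝ᵥ x)) ^ 2 ≤ (x ⬝ᵥ x) * (y ⬝ᵥ y) :=
      (pow_le_pow_left₀ (by positivity) h1 2).trans (hcs x y)
    rcases hxx0.eq_or_lt with h | h
    · rw [← h, mul_zero]; positivity
    · refine le_trans ?_ hyy
      refine le_of_mul_le_mul_left ?_ h
      calc _ = (c * (x ⬝ᵥ x)) ^ 2 := by ring
        _ ≤ _ := h2
  refine ⟨B *ᵥ x, ?_, ?_⟩
  · rw [← Matrix.mulVec_transpose, Matrix.mulVec_mulVec, hx]
  · have h1 : ∀ i, (B *ᵥ x) i ^ 2 ≤ Fintype.card n * L ^ 2 * (x ⬝ᵥ x) := fun i =>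
      (hcs (B i) x).trans (mul_le_mul_of_nonneg_right (hsq _ (hL i)) hxx0)
    calc ∑ i, (B *ᵥ x) i ^ 2 ≤ Fintype.card m * (Fintype.card n * L ^ 2 * (x ⬝ᵥ x)) := by
          rw [← nsmul_eq_mul, ← Finset.card_univ]
          exact Finset.sum_le_card_nsmul _ _ _ fun i _ => h1 i
      _ ≤ Fintype.card m * (Fintype.card n * L ^ 2 * (Fintype.card n * L ^ 2 / c ^ 2)) := by
          gcongr
          rw [le_div_iff₀ (by positivity), mul_comm]
          exact hxx
      _ = _ := by ring

namespace FactorModel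

variable {J T₀ T₁ r F : ℕ} {Ω : Type*} (M : FactorModel J T₀ T₁ r F Ω)

theorem pos_of_zeta_pos {E : Finset (Fin T₀)} (hzeta : 0 < M.zeta E) : 0 < E.card := by
  rcases Nat.eq_zero_or_pos E.card with h | h
  -- For empty `E`, division by zero makes `zeta` equal to 0.
  · simp [zeta, h] at hzeta
  · exact h

/-- The Gram matrix of the fitting loadings has smallest eigenvalue `zeta * T_E`, so the
coefficients spread over the fitting periods and their sum of squares is of order `1 / T_E`. -/
theorem exists_sum_smul_lam_eq {E : Finset (Fin T₀)} (hzeta : 0 < M.zeta E) {lamBar : ℝ}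
    (hlam : ∀ t k, |M.lam t k| ≤ lamBar) (t : Period T₀ T₁) :
    ∃ a : E → ℝ, ∑ s, a s • M.lam (Sum.inl s.1) = M.lam t ∧
      ∑ s, a s ^ 2 ≤ F ^ 2 * lamBar ^ 4 / (E.card * M.zeta E ^ 2) := by
  have hE : (0 : ℝ) < E.card := by exact_mod_cast M.pos_of_zeta_pos hzeta
  have hH := Matrix.isHermitian_conjTranspose_mul_self (M.lamE E)
  have hc : ∀ i, M.zeta E * E.card ≤ hH.eigenvalues i := fun i => by
    rw [zeta, div_mul_cancel₀ _ hE.ne']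
    exact ciInf_le (Set.finite_range _).bddBelow i
  obtain ⟨a, ha, ha'⟩ := exists_transpose_mulVec_eq (B := M.lamE E) (mul_pos hzeta hE)
    (fun x => by
      have := mul_dotProduct_le_of_le_eigenvalues hH hc x
      rwa [← Matrix.mulVec_mulVec, Matrix.dotProduct_mulVec, Matrix.vecMul_conjTranspose,
        star_trivial, star_trivial] at this)
    (L := lamBar) (fun i k => hlam _ _) (y := M.lam t) (hlam t)
  refine ⟨a, ?_, ha'.trans (le_of_eq ?_)⟩
  · rw [← ha, Matrix.vecMul_eq_sum]; rfl
  · rw [Fintype.card_coe, Fintype.card_fin]; field_simp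

/-- Perfect fit in a fitting period equates its factor term with minus the weighted shocks. Summing
over periods inside each unit leaves inner sums whose coefficients `a` do not involve the weights.
-/
theorem lam_dotProduct_imbalance {E : Finset (Fin T₀)} {a : E → ℝ} {t : Period T₀ T₁}
    (ha : ∑ s, a s • M.lam (Sum.inl s.1) = M.lam t) {W : (Fin J → ℝ) × (Fin J → ℝ)}
    (hW : ∑ j, weightDiff W j = 0) (hZ : ∑ j, weightDiff W j • M.Z j = 0) {ω : Ω}
    (hY : ∀ s ∈ E, ∑ j, weightDiff W j * M.YN j (Sum.inl s) ω = 0) :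
    M.lam t ⬝ᵥ M.imbalance W
      = -∑ j, weightDiff W j * ∑ s : E, a s * M.eps j (Sum.inl s.1) ω := by
  have h1 : ∀ s : E, M.lam (Sum.inl s.1) ⬝ᵥ M.imbalance W
      = -∑ j, weightDiff W j * M.eps j (Sum.inl s.1) ω := fun s => by
    have := M.sum_weightDiff_mul hW hZ (Sum.inl s.1) fun j => M.eps j (Sum.inl s.1) ω
    have h0 := hY s.1 s.2
    unfold YN at h0
    linarith
  rw [← ha, sum_dotProduct]
  simp only [smul_dotProduct, h1, smul_eq_mul, mul_neg, Finset.sum_neg_distrib, Finset.mul_sum]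
  rw [Finset.sum_comm]
  congr 1
  exact Finset.sum_congr rfl fun j _ => Finset.sum_congr rfl fun s _ => by ring

end FactorModel

/-! ### Sub-Gaussian tails and the size of the imbalance -/

/-- Two-sided tail bound for a linear combination of independent sub-Gaussian variables. -/
theorem measureReal_lt_abs_sum_le {Ω ι : Type*} [MeasurableSpace Ω] {P : Measure Ω}
    [IsProbabilityMeasure P] [Fintype ι] {X : ι → Ω → ℝ} (hX : iIndepFun X P) {c : ℝ≥0}
    (hsub : ∀ i, HasSubgaussianMGF (X i) c P) (a : ι → ℝ) {τ : ℝ} (hτ : 0 ≤ τ) :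
    P.real {ω | τ < |∑ i, a i * X i ω|} ≤ 2 * Real.exp (-τ ^ 2 / (2 * ((∑ i, a i ^ 2) * c))) := by
  have hsub' : ∀ i, HasSubgaussianMGF (fun ω => a i * X i ω) (Real.toNNReal (a i ^ 2) * c) P :=
    fun i => by
      rw [Real.toNNReal_of_nonneg (sq_nonneg _)]
      exact (hsub i).const_mul (a i)
  have hS : HasSubgaussianMGF (fun ω => ∑ i, a i * X i ω) (∑ i, Real.toNNReal (a i ^ 2) * c) P :=
    HasSubgaussianMGF.sum_of_iIndepFun (hX.comp (fun i x => a i * x) fun i => by fun_prop)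
      fun i _ => hsub' i
  have hcoe : ((∑ i, Real.toNNReal (a i ^ 2) * c : ℝ≥0) : ℝ) = (∑ i, a i ^ 2) * c := by
    push_cast [Finset.sum_mul]
    exact Finset.sum_congr rfl fun i _ => by rw [Real.coe_toNNReal _ (sq_nonneg _)]
  have h1 := hS.measure_ge_le hτ
  have h2 := hS.neg.measure_ge_le hτ
  rw [hcoe] at h1 h2
  have hsub : {ω | τ < |∑ i, a i * X i ω|} ⊆ {ω | τ ≤ ∑ i, a i * X i ω}
      ∪ {ω | τ ≤ (-fun ω => ∑ i, a i * X i ω) ω} := fun ω hω => by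
    rcases lt_abs.1 (show τ < |∑ i, a i * X i ω| from hω) with h | h
    · exact Or.inl h.le
    · exact Or.inr h.le
  calc _ ≤ _ := measureReal_mono hsub
    _ ≤ _ := measureReal_union_le _ _
    _ ≤ _ := by rw [two_mul]; exact add_le_add h1 h2

theorem measureReal_lt_abs_sum_le_of_le {Ω ι : Type*} [MeasurableSpace Ω] {P : Measure Ω}
    [IsProbabilityMeasure P] [Fintype ι] {X : ι → Ω → ℝ} (hX : iIndepFun X P) {c : ℝ≥0}
    (hsub : ∀ i, HasSubgaussianMGF (X i) c P) {a : ι → ℝ} {K : ℝ} (ha : ∑ i, a i ^ 2 ≤ K)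
    {τ : ℝ} (hτ : 0 ≤ τ) :
    P.real {ω | τ < |∑ i, a i * X i ω|} ≤ 2 * Real.exp (-(τ ^ 2 / (2 * (K * c)))) := by
  have h0 : 0 ≤ ∑ i, a i ^ 2 := Finset.sum_nonneg fun i _ => sq_nonneg _
  -- When all `a i` vanish, division by zero turns the previous bound into the useless 2, but the
  -- event is then empty.
  rcases h0.eq_or_lt with h | h
  · have ha0 : ∀ i, a i = 0 := fun i => by
      have := (Finset.sum_eq_zero_iff_of_nonneg fun i _ => sq_nonneg (a i)).1 h.symm i
        (Finset.mem_univ i)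
      exact pow_eq_zero_iff two_ne_zero |>.1 this
    simp only [ha0, zero_mul, Finset.sum_const_zero, abs_zero, hτ.not_gt]
    simpa using (Real.exp_pos _).le
  · refine (measureReal_lt_abs_sum_le hX hsub a hτ).trans ?_
    rw [neg_div]
    rcases (zero_le : 0 ≤ c).eq_or_lt with hc | hc
    · simp [← hc]
    · have : (0 : ℝ) < c := hc
      gcongr

theorem HasBoundedDensity.nonneg {Ω : Type*} [MeasurableSpace Ω] {P : Measure Ω} {X : Ω → ℝ} {κ : ℝ}
    (h : HasBoundedDensity X κ P) : 0 ≤ κ := by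
  obtain ⟨g, -, hg, -⟩ := h
  exact (hg 0).1.trans (hg 0).2

theorem HasBoundedDensity.map_le {Ω : Type*} [MeasurableSpace Ω] {P : Measure Ω} {X : Ω → ℝ} {κ : ℝ}
    (h : HasBoundedDensity X κ P) {A : Set ℝ} (hA : MeasurableSet A) :
    P.map X A ≤ ENNReal.ofReal κ * volume A := by
  obtain ⟨g, -, hg, hX⟩ := h
  rw [hX, withDensity_apply _ hA, ← setLIntegral_const]
  exact lintegral_mono fun x => ENNReal.ofReal_le_ofReal (hg x).2

theorem card_index {T₀ T₁ : ℕ} (E : Finset (Fin T₀)) :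
    (Fintype.card (Fin T₁ ⊕ Blank E) : ℝ) = (T₀ : ℝ) + T₁ - E.card := by
  have h : Fintype.card (Blank E) = T₀ - E.card := by
    simp [Fintype.card_subtype_compl]
  have hE : E.card ≤ T₀ := by simpa using E.card_le_univ
  rw [Fintype.card_sum, Fintype.card_fin, h]
  push_cast [Nat.cast_sub hE]
  ring

/-- Weights satisfying the constraints of the design problem without the bounds on the number of
treated units, with a perfect fit. -/
structure Balanced {J T₀ T₁ r F : ℕ} {Ω : Type*} (M : FactorModel J T₀ T₁ r F Ω)
    (E : Finset (Fin T₀)) (ω : Ω) (W : (Fin J → ℝ) × (Fin J → ℝ)) : Prop where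
  sum_fst : ∑ j, W.1 j = 1
  sum_snd : ∑ j, W.2 j = 1
  fst_nonneg : ∀ j, 0 ≤ W.1 j
  snd_nonneg : ∀ j, 0 ≤ W.2 j
  mul_eq_zero : ∀ j, W.1 j * W.2 j = 0
  covariates : ∑ j, weightDiff W j • M.Z j = 0
  outcomes : ∀ s ∈ E, ∑ j, weightDiff W j * M.YN j (Sum.inl s) ω = 0

namespace Balanced

variable {J T₀ T₁ r F : ℕ} {Ω : Type*} {M : FactorModel J T₀ T₁ r F Ω} {E : Finset (Fin T₀)}
  {ω : Ω} {W : (Fin J → ℝ) × (Fin J → ℝ)}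

theorem of_isSolution {f : Fin J → ℝ} {mlo mhi : ℕ} {V : Type*} [NormedAddCommGroup V]
    [NormedSpace ℝ V] {X : Fin J → V} (hsol : IsSolution mlo mhi f X W.1 W.2)
    (hw : M.PerfectFit E f ω W.1) (hv : M.PerfectFit E f ω W.2) : Balanced M E ω W where
  sum_fst := hsol.1.1
  sum_snd := hsol.1.2.1
  fst_nonneg j := (hsol.1.2.2.1 j).1
  snd_nonneg j := (hsol.1.2.2.1 j).2
  mul_eq_zero := hsol.1.2.2.2.1
  covariates := by
    simp only [weightDiff, sub_smul, Finset.sum_sub_distrib, hw.1, hv.1, sub_self]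
  outcomes s hs := by
    simp only [weightDiff, sub_mul, Finset.sum_sub_distrib, hw.2 s hs, hv.2 s hs, sub_self]

theorem sum_weightDiff (h : Balanced M E ω W) : ∑ j, weightDiff W j = 0 := by
  simp only [weightDiff, Finset.sum_sub_distrib, h.sum_fst, h.sum_snd, sub_self]

theorem sum_abs_weightDiff_le (h : Balanced M E ω W) : ∑ j, |weightDiff W j| ≤ 2 := by
  calc ∑ j, |weightDiff W j| ≤ ∑ j, (W.1 j + W.2 j) := Finset.sum_le_sum fun j _ => by
        unfold weightDiff
        have h1 := h.fst_nonneg j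
        have h2 := h.snd_nonneg j
        exact abs_le.2 ⟨by linarith, by linarith⟩
    _ = 2 := by rw [Finset.sum_add_distrib, h.sum_fst, h.sum_snd]; norm_num

end Balanced

namespace FactorModel

variable {J T₀ T₁ r F : ℕ} {Ω : Type*} (M : FactorModel J T₀ T₁ r F Ω)
  [MeasurableSpace Ω] {P : Measure Ω} [IsProbabilityMeasure P]

/-- The effect of the imbalance of the unobserved covariates is small with high probability. -/
theorem measureReal_imbalance_le (E : Finset (Fin T₀)) (hzeta : 0 < M.zeta E) {lamBar : ℝ}
    (hlam : ∀ t k, |M.lam t k| ≤ lamBar)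
    (hindep : iIndepFun (fun p : Fin J × Period T₀ T₁ => M.shocks p.1 p.2) P) {sigmaBar : ℝ≥0}
    (hsub : ∀ j t, HasSubgaussianMGF (M.eps j t) (sigmaBar ^ 2) P)
    {W : Ω → (Fin J → ℝ) × (Fin J → ℝ)} (hW : ∀ᵐ ω ∂P, Balanced M E ω (W ω)) {δ : ℝ} (hδ : 0 ≤ δ) :
    P.real {ω | ∃ i : Fin T₁ ⊕ Blank E, δ < |M.lam (indexPeriod i) ⬝ᵥ M.imbalance (W ω)|}
      ≤ 2 * J * ((T₀ : ℝ) + T₁ - E.card) * Real.exp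
        (-(M.zeta E ^ 2 / (8 * sigmaBar ^ 2 * lamBar ^ 4 * (F : ℝ) ^ 2)) * (E.card * δ ^ 2)) := by
  choose a ha hasq using fun i : Fin T₁ ⊕ Blank E =>
    M.exists_sum_smul_lam_eq hzeta hlam (indexPeriod i)
  -- The weights depend on these same shocks, so the tail bound is applied unit by unit to sums free
  -- of the weights. The threshold is `δ / 2` because the `|c j|` add up to at most 2.
  let U : (Fin T₁ ⊕ Blank E) × Fin J → Set Ω := fun k =>
    {ω | δ / 2 < |∑ s : E, a k.1 s * M.eps k.2 (Sum.inl s.1) ω|}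
  have hE : (0 : ℝ) < E.card := by exact_mod_cast M.pos_of_zeta_pos hzeta
  have hU : ∀ k, P.real (U k) ≤ 2 * Real.exp
      (-(M.zeta E ^ 2 / (8 * sigmaBar ^ 2 * lamBar ^ 4 * (F : ℝ) ^ 2)) * (E.card * δ ^ 2)) := by
    intro k
    have hinj : Function.Injective fun s : E => (k.2, (Sum.inl s.1 : Period T₀ T₁)) :=
      fun s s' h => Subtype.ext (Sum.inl_injective (Prod.ext_iff.1 h).2)
    have hind : iIndepFun (fun s : E => M.eps k.2 (Sum.inl s.1)) P :=
      (hindep.precomp hinj).comp (fun _ => Prod.fst) fun _ => measurable_fst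
    refine (measureReal_lt_abs_sum_le_of_le hind (fun s => hsub _ _) (hasq k.1)
      (by positivity)).trans (le_of_eq ?_)
    congr 2
    push_cast
    rw [neg_mul]
    congr 1
    rw [div_pow, div_mul_eq_mul_div, div_mul_eq_mul_div, ← mul_div_assoc, div_div_eq_mul_div]
    rw [div_mul_eq_mul_div, div_div]
    congr 1 <;> ring
  have hsubset : {ω | ∃ i : Fin T₁ ⊕ Blank E, δ < |M.lam (indexPeriod i) ⬝ᵥ M.imbalance (W ω)|}
      ≤ᵐ[P] ⋃ k, U k := by
    filter_upwards [hW] with ω hω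
    rintro ⟨i, hi⟩
    by_contra hnot
    have hnot : ∀ j, |∑ s : E, a i s * M.eps j (Sum.inl s.1) ω| ≤ δ / 2 := fun j => by
      by_contra! h
      exact hnot (Set.mem_iUnion.2 ⟨(i, j), h⟩)
    refine absurd hi (not_lt.2 ?_)
    rw [M.lam_dotProduct_imbalance (ha i) hω.sum_weightDiff hω.covariates hω.outcomes, abs_neg]
    calc _ ≤ ∑ j, |weightDiff (W ω) j| * (δ / 2) := by
          refine (Finset.abs_sum_le_sum_abs _ _).trans (Finset.sum_le_sum fun j _ => ?_)
          rw [abs_mul]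
          exact mul_le_mul_of_nonneg_left (hnot j) (abs_nonneg _)
      _ ≤ 2 * (δ / 2) := by
          rw [← Finset.sum_mul]
          exact mul_le_mul_of_nonneg_right hω.sum_abs_weightDiff_le (by positivity)
      _ = δ := by ring
  calc _ ≤ P.real (⋃ k, U k) := ENNReal.toReal_mono (measure_ne_top _ _) (measure_mono_ae hsubset)
    _ ≤ ∑ k, P.real (U k) := measureReal_iUnion_fintype_le _
    _ ≤ Fintype.card ((Fin T₁ ⊕ Blank E) × Fin J) * (2 * Real.exp
      (-(M.zeta E ^ 2 / (8 * sigmaBar ^ 2 * lamBar ^ 4 * (F : ℝ) ^ 2)) * (E.card * δ ^ 2))) := by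
        rw [← nsmul_eq_mul, ← Finset.card_univ]
        exact Finset.sum_le_card_nsmul _ _ _ fun k _ => hU k
    _ = _ := by
        rw [Fintype.card_prod, Fintype.card_fin, Nat.cast_mul, card_index]
        ring

end FactorModel

/-! ### Separation of the statistics and the good event -/

/-- The statistics of different combinations are well separated with high probability. -/
theorem prod_not_separated_le {ι : Type*} [Fintype ι] {J n : ℕ}
    (Q : Measure ((Fin J → ℝ) × (Fin J → ℝ))) [IsProbabilityMeasure Q] (ν : Measure ℝ)
    [IsProbabilityMeasure ν] {κ : ℝ} (hκ : 0 ≤ κ)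
    (hν : ∀ A, MeasurableSet A → ν A ≤ ENNReal.ofReal κ * volume A) (hJ : 0 < J)
    (hQ : ∀ᵐ W ∂Q, ∃ j, 2 / (J : ℝ) ≤ |weightDiff W j|) {b : ℝ} (hb : 0 ≤ b) :
    (Q.prod (Measure.pi fun _ : ι × Fin J => ν)).real
        {p | ¬ Separated (Finset.powersetCard n Finset.univ) b
          (absSum (combine (weightDiff p.1) p.2))}
      ≤ J * κ * ((Finset.powersetCard n (Finset.univ : Finset ι)).card : ℝ) ^ 2 * b := by
  classical
  set s : Finset (Finset ι) := Finset.powersetCard n Finset.univ with hs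
  have hJ' : (0 : ℝ) < J := by exact_mod_cast hJ
  have hmeas : MeasurableSet {p : ((Fin J → ℝ) × (Fin J → ℝ)) × (ι × Fin J → ℝ) |
      ¬ Separated s b (absSum (combine (weightDiff p.1) p.2))} :=
    (measurableSet_separated s b measurable_absSum_combine_weightDiff).compl
  -- Distinct combinations have equal size, so neither contains the other. With `a = 2 / J` each
  -- pair costs `2 * J * κ * b`, and the factor 2 is offset by counting unordered pairs.
  have hslice : ∀ᵐ W ∂Q, 2 * Measure.pi (fun _ : ι × Fin J => ν)
      {x | ¬ Separated s b (absSum (combine (weightDiff W) x))}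
      ≤ (s.card : ℝ≥0∞) ^ 2 * ENNReal.ofReal (κ * (4 * b / (2 / J))) := by
    filter_upwards [hQ] with W hW
    obtain ⟨j, hj⟩ := hW
    refine two_mul_measure_not_separated_le _ s b _ _ fun π hπ π' hπ' hne => ?_
    refine pi_absSum_sub_le hκ hν (by positivity) hj (fun hsub => hne ?_) hb
    exact Finset.eq_of_subset_of_card_le hsub
      ((Finset.mem_powersetCard.1 hπ').2.trans (Finset.mem_powersetCard.1 hπ).2.symm).le
  have htotal : 2 * (Q.prod (Measure.pi fun _ : ι × Fin J => ν))
      {p | ¬ Separated s b (absSum (combine (weightDiff p.1) p.2))}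
      ≤ (s.card : ℝ≥0∞) ^ 2 * ENNReal.ofReal (κ * (4 * b / (2 / J))) := by
    rw [Measure.prod_apply hmeas, ← lintegral_const_mul _ (measurable_measure_prodMk_left hmeas)]
    refine (lintegral_mono_ae (g := fun _ => _) hslice).trans ?_
    rw [lintegral_const, measure_univ, mul_one]
  have hreal := ENNReal.toReal_mono (by finiteness) htotal
  rw [ENNReal.toReal_mul, ENNReal.toReal_mul, ENNReal.toReal_pow, ENNReal.toReal_natCast,
    ENNReal.toReal_ofReal (by positivity), ENNReal.toReal_ofNat] at hreal
  have h4 : κ * (4 * b / (2 / J)) = 2 * (J * κ * b) := by field_simp; ring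
  rw [h4] at hreal
  unfold Measure.real
  linarith

/-- The event on which the imbalances are at most `δ` and the statistics of the noise separated. -/
def rankEvent {J T₀ T₁ r F : ℕ} {Ω : Type*} (M : FactorModel J T₀ T₁ r F Ω) (E : Finset (Fin T₀))
    (δ : ℝ) : Set (((Fin J → ℝ) × (Fin J → ℝ)) × ((Fin T₁ ⊕ Blank E) × Fin J → ℝ)) :=
  {p | (∀ i : Fin T₁ ⊕ Blank E, |M.lam (indexPeriod i) ⬝ᵥ M.imbalance p.1| ≤ δ) ∧
    Separated (combinations T₁ E) (2 * (T₁ * δ)) (absSum (combine (weightDiff p.1) p.2))}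

theorem measurableSet_imbalance_le {J T₀ T₁ r F : ℕ} {Ω : Type*} (M : FactorModel J T₀ T₁ r F Ω)
    (E : Finset (Fin T₀)) (δ : ℝ) : MeasurableSet {W : (Fin J → ℝ) × (Fin J → ℝ) |
      ∀ i : Fin T₁ ⊕ Blank E, |M.lam (indexPeriod i) ⬝ᵥ M.imbalance W| ≤ δ} := by
  have hd : ∀ k, Measurable fun W => M.imbalance W k :=
    fun k => (measurable_pi_apply k).comp M.measurable_imbalance
  simp only [Set.ofPred_forall, dotProduct]
  refine MeasurableSet.iInter fun i => measurableSet_le ?_ measurable_const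
  exact (Finset.measurable_sum _ fun k _ => (hd k).const_mul _).abs

theorem measurableSet_rankEvent {J T₀ T₁ r F : ℕ} {Ω : Type*} (M : FactorModel J T₀ T₁ r F Ω)
    (E : Finset (Fin T₀)) (δ : ℝ) : MeasurableSet (rankEvent M E δ) :=
  (measurable_fst (measurableSet_imbalance_le M E δ)).inter
    (measurableSet_separated _ _ measurable_absSum_combine_weightDiff)

/-- On the rank event, the `p`-value of `r̂` is determined by the rank of the noise statistic. -/
theorem pValue_rhat_eq {J T₀ T₁ r F : ℕ} {Ω : Type*} [MeasurableSpace Ω] {P : Measure Ω}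
    {M : FactorModel J T₀ T₁ r F Ω} (hT₁ : 0 < T₁) (hnull : M.NullHypothesis P)
    {E : Finset (Fin T₀)} {w v : Ω → Fin J → ℝ} {ω : Ω} (h : Balanced M E ω (w ω, v ω)) {δ : ℝ}
    (hω : ((w ω, v ω), fun k => selectShock (w ω, v ω) k (M.noise E ω k)) ∈ rankEvent M E δ) :
    pValue E (M.rhat E w v ω) = (rankIn (combinations T₁ E) (absSum (combine
      (weightDiff (w ω, v ω)) fun k => selectShock (w ω, v ω) k (M.noise E ω k))) (postSet T₁ E) : ℝ)
      / ((combinations T₁ E).card : ℝ) := by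
  rw [pValue_eq hT₁, hω.2.rankIn_eq (fun π hπ => ?_) (postSet_mem T₁ E)]
  -- Each of the `T₁` coordinates moves by at most `δ`, so the sums move by at most half of the
  -- separation.
  have hdiff := abs_absSum_sub_le (ρ := combine (weightDiff (w ω, v ω))
    fun k => selectShock (w ω, v ω) k (M.noise E ω k)) (ρ' := M.rhat E w v ω) (δ := δ) (fun i => by
      rw [M.rhat_eq hnull h.sum_weightDiff h.covariates, add_sub_cancel_left]
      exact hω.1 i) π
  rwa [(Finset.mem_powersetCard.1 hπ).2] at hdiff

theorem card_combinations_pos {T₀ : ℕ} (T₁ : ℕ) (E : Finset (Fin T₀)) :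
    0 < (combinations T₁ E).card :=
  Finset.card_pos.2 ⟨_, postSet_mem T₁ E⟩

end SCDesign

/-! ### Proof of the theorem -/

open SCDesign in
theorem theorem2 {Ω : Type*} [MeasurableSpace Ω] (P : Measure Ω) [IsProbabilityMeasure P]
    {J T₀ T₁ r F : ℕ} (M : FactorModel J T₀ T₁ r F Ω)
    -- at least one post-intervention period; the set of fitting periods
    (hT₁ : 0 < T₁) (E : Finset (Fin T₀))
    -- population weights, and bounds on the number of treated units
    (f : Fin J → ℝ) (hf_pos : ∀ j, 0 < f j) (hf_sum : ∑ j, f j = 1)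
    (mlo mhi : ℕ) (hmlo : 1 ≤ mlo) (hm : mlo ≤ mhi) (hmhi : mhi + 1 ≤ J)
    -- bounded loadings
    (lamBar etaBar : ℝ) (hlam : ∀ t k, |M.lam t k| ≤ lamBar) (heta : ∀ t k, |M.eta t k| ≤ etaBar)
    -- at least as many fitting periods as factors; smallest eigenvalue bounded away from zero
    (hF : F ≤ E.card) (hzeta : 0 < M.zeta E)
    -- the shocks are random variables, independent over units and periods, with mean zero and
    -- sub-Gaussian with variance proxy `sigmaBar ^ 2`
    (heps_meas : ∀ j t, Measurable (M.eps j t)) (hxi_meas : ∀ j t, Measurable (M.xi j t))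
    (hindep : iIndepFun (fun p : Fin J × Period T₀ T₁ => M.shocks p.1 p.2) P)
    (sigmaBar : ℝ≥0)
    (heps_mean : ∀ j t, ∫ ω, M.eps j t ω ∂P = 0) (hxi_mean : ∀ j t, ∫ ω, M.xi j t ω ∂P = 0)
    (heps_subG : ∀ j t, HasSubgaussianMGF (M.eps j t) (sigmaBar ^ 2) P)
    (hxi_subG : ∀ j t, HasSubgaussianMGF (M.xi j t) (sigmaBar ^ 2) P)
    -- outside the fitting periods they are identically distributed, with density bounded by `κ`
    (heps_ident : ∀ j j' : Fin J, ∀ t ∈ nonFitting T₁ E, ∀ t' ∈ nonFitting T₁ E,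
      IdentDistrib (M.eps j t) (M.eps j' t') P P)
    (κ : ℝ) (hdens : ∀ j : Fin J, ∀ t ∈ nonFitting T₁ E, HasBoundedDensity (M.eps j t) κ P)
    -- the weights are computed from the predictors, solve the design problem, and fit perfectly
    (w v : Ω → Fin J → ℝ)
    (hw_meas : Measurable[MeasurableSpace.comap (M.predictors E) inferInstance] w)
    (hv_meas : Measurable[MeasurableSpace.comap (M.predictors E) inferInstance] v)
    (hsol : ∀ᵐ ω ∂P, IsSolution mlo mhi f (M.predictors E ω) (w ω) (v ω))
    (hfit : ∀ᵐ ω ∂P, M.PerfectFit E f ω (w ω) ∧ M.PerfectFit E f ω (v ω))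
    -- the null hypothesis of no treatment effect
    (hnull : M.NullHypothesis P) :
    ∃ C : Set Ω, MeasurableSet C ∧
      1 - c₁ J T₀ T₁ F E (M.zeta E) sigmaBar lamBar κ ≤ P.real C ∧
      (P C ≠ 0 → ∀ α : ℝ, 0 < α → α ≤ 1 →
        α - 1 / ((combinations T₁ E).card : ℝ)
            ≤ (ProbabilityTheory.cond P C).real {ω | pValue E (M.rhat E w v ω) ≤ α} ∧
        (ProbabilityTheory.cond P C).real {ω | pValue E (M.rhat E w v ω) ≤ α} ≤ α) := by
  classical
  set W : Ω → (Fin J → ℝ) × (Fin J → ℝ) := fun ω => (w ω, v ω) with hWdef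
  have hW : Measurable[MeasurableSpace.comap (M.predictors E) inferInstance] W :=
    Measurable.prodMk hw_meas hv_meas
  have hWm : Measurable W := hW.mono (M.measurable_predictors heps_meas E).comap_le le_rfl
  have hbal : ∀ᵐ ω ∂P, Balanced M E ω (W ω) := by
    filter_upwards [hsol, hfit] with ω h1 h2
    exact Balanced.of_isSolution h1 h2.1 h2.2
  have hJ : 0 < J := by omega
  let j₀ : Fin J := ⟨0, hJ⟩
  let t₀ : Period T₀ T₁ := Sum.inr ⟨0, hT₁⟩
  have ht₀ : t₀ ∈ nonFitting T₁ E := fun s _ => by simp [t₀]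
  have hκ : 0 ≤ κ := (hdens j₀ t₀ ht₀).nonneg
  let ν : Measure ℝ := P.map (M.eps j₀ t₀)
  have : IsProbabilityMeasure ν := Measure.isProbabilityMeasure_map (heps_meas _ _).aemeasurable
  have : IsProbabilityMeasure (P.map W) := Measure.isProbabilityMeasure_map hWm.aemeasurable
  have hmp := M.measurePreserving_weights_shocks heps_meas hxi_meas hindep E hnull (ν := ν)
    (fun j t ht => (heps_ident j j₀ t ht t₀ ht₀).map_eq) hW
  set μ := (P.map W).prod (Measure.pi fun _ : (Fin T₁ ⊕ Blank E) × Fin J => ν)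
  set Φ := fun ω => (W ω, fun k => selectShock (W ω) k (M.noise E ω k))
  have hE : (0 : ℝ) < E.card := by exact_mod_cast M.pos_of_zeta_pos hzeta
  -- This `δ` makes the tail exponent `T_E * δ ^ 2` equal to `√T_E`, while the separation cost is
  -- linear in `δ`.
  set δ : ℝ := (E.card : ℝ) ^ (-(1 / 4) : ℝ) with hδdef
  have hδ : 0 ≤ δ := by positivity
  have hδsq : E.card * δ ^ 2 = Real.sqrt E.card := by
    rw [hδdef, ← Real.rpow_natCast, ← Real.rpow_mul hE.le, Real.sqrt_eq_rpow]
    nth_rewrite 1 [← Real.rpow_one (E.card : ℝ)]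
    rw [← Real.rpow_add hE]
    norm_num
  have hb : 0 ≤ 2 * (T₁ * δ) := by positivity
  have hR := measurableSet_rankEvent M E δ
  refine ⟨Φ ⁻¹' rankEvent M E δ, hmp.measurable hR, ?_, ?_⟩
  · have hQ : ∀ᵐ W ∂P.map W, ∃ j, 2 / (J : ℝ) ≤ |weightDiff W j| := by
      have hmeas : MeasurableSet {W : (Fin J → ℝ) × (Fin J → ℝ) |
          ∃ j, 2 / (J : ℝ) ≤ |weightDiff W j|} := by
        simp only [Set.ofPred_exists]
        exact MeasurableSet.iUnion fun j => measurableSet_le measurable_const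
          ((measurable_pi_apply j).comp measurable_weightDiff).abs
      rw [ae_map_iff hWm.aemeasurable hmeas]
      filter_upwards [hbal] with ω h
      exact exists_two_div_le_abs_sub h.sum_fst h.sum_snd h.fst_nonneg h.snd_nonneg h.mul_eq_zero
    have h1 := M.measureReal_imbalance_le E hzeta hlam hindep heps_subG hbal hδ
    have h2 := prod_not_separated_le (ι := Fin T₁ ⊕ Blank E) (n := T₁) (P.map W) ν hκ
      (fun A hA => (hdens j₀ t₀ ht₀).map_le hA) hJ hQ hb
    have hsep : MeasurableSet {p : ((Fin J → ℝ) × (Fin J → ℝ)) × ((Fin T₁ ⊕ Blank E) × Fin J → ℝ) |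
        ¬ Separated (combinations T₁ E) (2 * (T₁ * δ))
          (absSum (combine (weightDiff p.1) p.2))} :=
      (measurableSet_separated _ _ measurable_absSum_combine_weightDiff).compl
    have h3 := (hmp.measureReal_preimage hsep.nullMeasurableSet).trans_le h2
    have hcompl : (Φ ⁻¹' rankEvent M E δ)ᶜ
        ⊆ {ω | ∃ i : Fin T₁ ⊕ Blank E, δ < |M.lam (indexPeriod i) ⬝ᵥ M.imbalance (W ω)|}
          ∪ Φ ⁻¹' {p | ¬ Separated (combinations T₁ E) (2 * (T₁ * δ))
              (absSum (combine (weightDiff p.1) p.2))} := by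
      intro ω hω
      by_cases h : ∃ i : Fin T₁ ⊕ Blank E, δ < |M.lam (indexPeriod i) ⬝ᵥ M.imbalance (W ω)|
      · exact Or.inl h
      · push Not at h
        exact Or.inr fun h' => hω ⟨h, h'⟩
    have h4 := (measureReal_mono (μ := P) hcompl).trans (measureReal_union_le _ _)
    rw [probReal_compl_eq_one_sub (hmp.measurable hR)] at h4
    rw [hδsq] at h1
    have h5 : c₁ J T₀ T₁ F E (M.zeta E) sigmaBar lamBar κ
        = 2 * J * ((T₀ : ℝ) + T₁ - E.card) * Real.exp
        (-(M.zeta E ^ 2 / (8 * sigmaBar ^ 2 * lamBar ^ 4 * (F : ℝ) ^ 2)) * Real.sqrt E.card)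
        + J * κ * ((combinations T₁ E).card : ℝ) ^ 2 * (2 * (T₁ * δ)) := by
      unfold c₁; ring
    rw [h5]
    change _ ≤ J * κ * ((combinations T₁ E).card : ℝ) ^ 2 * (2 * (T₁ * δ)) at h3
    linarith
  · intro hC α hα0 hα1
    set C := Φ ⁻¹' rankEvent M E δ
    have hN : (0 : ℝ) < (combinations T₁ E).card := by exact_mod_cast card_combinations_pos T₁ E
    -- The rank is an integer, so on the good event, up to a null set, `p̂ ≤ α` means rank at most
    -- `m`.
    set m := ⌊α * (combinations T₁ E).card⌋₊ with hm
    have hmN : m ≤ (combinations T₁ E).card := by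
      rw [hm]
      refine Nat.floor_le_of_le ?_
      nlinarith
    let R := {p : ((Fin J → ℝ) × (Fin J → ℝ)) × ((Fin T₁ ⊕ Blank E) × Fin J → ℝ) |
      p ∈ rankEvent M E δ ∧ rankIn (combinations T₁ E) (absSum (combine (weightDiff p.1) p.2))
        (postSet T₁ E) ≤ m}
    have hRm : MeasurableSet R := hR.inter (measurableSet_le
      (measurable_rankIn _ measurable_absSum_combine_weightDiff _) measurable_const)
    have hcount : ((combinations T₁ E).card : ℝ≥0∞) * μ R = m * μ (rankEvent M E δ) :=
      card_mul_measure_rankIn_le (P.map W) ν (measurableSet_imbalance_le M E δ) hb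
        (postSet_mem T₁ E) hmN
    have hCR : P (C ∩ {ω | pValue E (M.rhat E w v ω) ≤ α}) = μ R := by
      rw [← hmp.measure_preimage hRm.nullMeasurableSet]
      refine measure_congr ?_
      filter_upwards [hbal] with ω hω
      refine propext (and_congr_right fun hωC => ?_)
      change pValue E (M.rhat E w v ω) ≤ α ↔ _
      rw [pValue_rhat_eq hT₁ hnull hω hωC, div_le_iff₀ hN, hm, Nat.le_floor_iff (by positivity)]
    rw [← hCR, ← hmp.measure_preimage hR.nullMeasurableSet] at hcount
    have hcountR := congrArg ENNReal.toReal hcount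
    simp only [ENNReal.toReal_mul, ENNReal.toReal_natCast] at hcountR
    have hPC : 0 < (P C).toReal := ENNReal.toReal_pos hC (measure_ne_top _ _)
    -- Both bounds of the theorem are the rounding error in `⌊α|Π|⌋ / |Π|`.
    have hcond : (ProbabilityTheory.cond P C).real {ω | pValue E (M.rhat E w v ω) ≤ α}
        = m / (combinations T₁ E).card := by
      unfold Measure.real
      rw [cond_apply (hmp.measurable hR), ENNReal.toReal_mul, ENNReal.toReal_inv, eq_div_iff hN.ne',
        mul_assoc, mul_comm (P _).toReal (_ : ℝ), hcountR, mul_comm (m : ℝ),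
        inv_mul_cancel_left₀ hPC.ne']
    rw [hcond]
    constructor
    · rw [le_div_iff₀ hN, sub_mul, one_div, inv_mul_cancel₀ hN.ne']
      linarith [Nat.lt_floor_add_one (α * ((combinations T₁ E).card : ℝ))]
    · rw [div_le_iff₀ hN]
      exact Nat.floor_le (by positivity)
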